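/- There are an absolute constant $K$ and an absolute exponent $k\in\mathbb N$ such that the following holds. Let $D$ be a probability distribution on $\mathbb R^d\times\{0,1\}$ whose $x$-marginal is the standard normal distribution, and let $\mathcal C$ be a finite class of (measurable) classifiers $c:\mathbb R^d\to\{0,1\}$. For $w\in\mathbb R^d$ put $h(w)=\{x:\langle x,w\rangle\ge 0\}$. Let $0<\epsilon\le 1/e$ and $0<\delta<1$, and suppose that for some unit vector $v\in\mathbb R^d$ $$\min_{c\in\mathcal C}\ \mathbb P_{(x,y)\sim D}\big[x\in h(v),\ c(x)\ne y\big]\le\epsilon .$$ Consider the following algorithm. Let (rounding up to integers) $T=\lceil(4d+\ln(8|\mathcal C|/\delta))/\epsilon^4\rceil$, $N=\lceil1600\ln^2(16T|\mathcal C|/\delta)/\epsilon^2\rceil$, $M=\lceil\ln(4|\mathcal C|T/\delta)/(2\epsilon)\rceil$ and $\beta=\sqrt{1/(Td)}$. Draw $2TN+M$ independent examples from $D$: two groups of $T$ batches of $N$ examples, and a set $\hat D$ of $M$ examples. Fix any unit vector $w_0$. For each $c\in\mathcal C$, replace the label $y$ of every example of the batches by $\mathbf 1[c(x)\ne y]$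 (the same examples are used for all $c$), and run projected SGD from $w^{(0)}=w_0$ with the first group and from $w^{(0)}=-w_0$ with the second group: for $i=1,\dots,T$, $$u^{(i)}=w^{(i-1)}-\beta\,\widehat{\mathbb E}_i\big[g_{w^{(i-1)}}(x,y)\big],\qquad w^{(i)}=u^{(i)}/\|u^{(i)}\|_2,$$ where $\widehat{\mathbb E}_i$ is the average over the $i$-th relabelled batch and $g_w(x,y)=y\,\big(x-\langle x,w\rangle w/\|w\|_2^2\big)\mathbf 1[x\in h(w)]$. Let $w(c)$ be a vector among the $2T$ iterates $w^{(1)},\dots,w^{(T)}$ of the two runs that minimizes the empirical error $\mathbb P_{\hat D}[x\in h(w),\ c(x)\ne y]$. Return the pair $(c,w(c))$ with the smallest value of $\mathbb P_{\hat D}[x\in h(w(c)),\ c(x)\ne y]$ over $c\in\mathcal C$. Then: 1. the number of examples drawn is at most $K\,\dfrac{d}{\epsilon^6}\,\ln^k\!\Big(\dfrac{d|\mathcal C|}{\epsilon\delta}\Big)=\tilde O(d/\epsilon^6)$; 2. on every sample the running time is at most $K\,\dfrac{d|\mathcal C|}{\epsilon^6}\,\ln^k\!\Big(\dfrac{d|\mathcal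 C|}{\epsilon\delta}\Big)=\tilde O(d|\mathcal C|/\epsilon^6)$, where drawing or accessing an example, an operation on vectors of $\mathbb R^d$ (inner product, norm, sum, scalar multiple), an evaluation of a classifier, and an operation on numbers each take one unit of time; 3. with probability at least $1-\delta$ over the examples, the returned pair $(c,w(c))$ satisfies $c\in\mathcal C$, $\|w(c)\|_2=1$ and $$\mathbb P_{(x,y)\sim D}\big[x\in h(w(c)),\ c(x)\ne y\big]\le K\sqrt\epsilon\,\ln^k(1/\epsilon)=\tilde O(\sqrt\epsilon).$$ -/

import Mathlib

noncomputable section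

namespace CondClass

open MeasureTheory ProbabilityTheory

/-! ### Computations with a step counter -/

/-- A result together with the number of elementary steps spent on computing it. -/
@[ext]
structure Timed (α : Type) where
  val : α
  steps : ℕ

instance : Monad Timed where
  pure a := ⟨a, 0⟩
  bind m f := ⟨(f m.val).val, m.steps + (f m.val).steps⟩

/-- One elementary step with result `a`. It is used only for the elementary operations named
below and for single operations on numbers and Booleans. -/
def step {α : Type} (a : α) : Timed α := ⟨a, 1⟩

/-- The feature space `ℝ^d` with its Euclidean norm. -/
abbrev Vec (d : ℕ) : Type := EuclideanSpace ℝ (Fin d)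

/-- Binary classifiers on `ℝ^d`. -/
abbrev Classifier (d : ℕ) : Type := Vec d → Bool

/-- Labelled examples `(x, y)`, with `y ∈ {0, 1}`. -/
abbrev Example (d : ℕ) : Type := Vec d × Bool

/-- The homogeneous halfspace `h(w) = {x | ⟨x, w⟩ ≥ 0}`. -/
def halfspace {d : ℕ} (w : Vec d) : Set (Vec d) := {x | 0 ≤ inner ℝ x w}

/-- The event `x ∈ h(w) ∩ c(x) ≠ y`. -/
def errorSet {d : ℕ} (c : Classifier d) (w : Vec d) : Set (Example d) :=
  {z | z.1 ∈ halfspace w ∧ c z.1 ≠ z.2}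

/-! ### Elementary operations, one step each -/

section Operations

variable {d : ℕ}

/-- Inner product of two vectors. -/
def vInner (x w : Vec d) : Timed ℝ := step (inner ℝ x w)

/-- Euclidean norm of a vector. -/
def vNorm (w : Vec d) : Timed ℝ := step ‖w‖

/-- Multiple of a vector. -/
def vScale (a : ℝ) (w : Vec d) : Timed (Vec d) := step (a • w)

/-- Sum of two vectors. -/
def vAdd (x w : Vec d) : Timed (Vec d) := step (x + w)

/-- Evaluation of a classifier at a point. -/
def classify (c : Classifier d) (x : Vec d) : Timed Bool := step (c x)

/-- Access to one example. -/
def fetch (z : Example d) : Timed (Example d) := step z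

open Classical in
/-- Comparison of two real numbers. -/
def leq (a b : ℝ) : Timed Bool := step (decide (a ≤ b))

/-- Normalization `w / ‖w‖`. -/
def vNormalize (w : Vec d) : Timed (Vec d) := do
  let n ← vNorm w
  let r ← step n⁻¹
  vScale r w

/-! ### Projected stochastic gradient descent -/

/-- The projected gradient `g_w(x, y) = y · x_{w^⊥} · 1[x ∈ h(w)]`,
where `x_{w^⊥} = x - ⟨x, w/‖w‖⟩ w/‖w‖`. -/
def projGrad (w : Vec d) (z : Example d) : Timed (Vec d) := do
  let z ← fetch z
  let s ← vInner z.1 w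
  let pos ← leq 0 s
  let active ← step (z.2 && pos)
  if active then
    let u ← vNormalize w
    let r ← vInner z.1 u
    let r' ← step (-r)
    let p ← vScale r' u
    vAdd z.1 p
  else
    step 0

/-- The sum of `g_w` over a list of examples. -/
def sumGrad (w : Vec d) : List (Example d) → Timed (Vec d)
  | [] => step 0
  | z :: zs => do
      let g ← projGrad w z
      let s ← sumGrad w zs
      vAdd g s

/-- One update: `u = w - β · (empirical mean of g_w over the batch)`, followed by `u / ‖u‖`. -/
def psgdUpdate (β : ℝ) (batch : List (Example d)) (w : Vec d) : Timed (Vec d) := do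
  let s ← sumGrad w batch
  let a ← step (-(β / (batch.length : ℝ)))
  let t ← vScale a s
  let u ← vAdd w t
  vNormalize u

/-- The iterates `w(1), w(2), …` obtained from `w = w(0)`, one batch for each iteration. -/
def psgdLoop (β : ℝ) : List (List (Example d)) → Vec d → Timed (List (Vec d))
  | [], _ => pure []
  | batch :: batches, w => do
      let w' ← psgdUpdate β batch w
      let ws ← psgdLoop β batches w'
      step (w' :: ws)

/-- Projected SGD with step size `β = √(1/(T d))`, where `T` is the number of batches.
It returns `w(1), …, w(T)`. -/
def psgd (batches : List (List (Example d))) (w₀ : Vec d) : Timed (List (Vec d)) := do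
  let β ← step (Real.sqrt (1 / ((batches.length : ℝ) * (d : ℝ))))
  psgdLoop β batches w₀

/-! ### Relabelling, empirical error, minimization over lists -/

/-- `(x, y) ↦ (x, 1[c(x) ≠ y])`. -/
def relabel (c : Classifier d) (z : Example d) : Timed (Example d) := do
  let z ← fetch z
  let b ← classify c z.1
  step (z.1, b ^^ z.2)

/-- Apply a timed function to all members of a list. -/
def mapList {α γ : Type} (f : α → Timed γ) : List α → Timed (List γ)
  | [] => pure []
  | a :: as => do
      let b ← f a
      let bs ← mapList f as
      step (b :: bs)

/-- The number of examples in a list with `x ∈ h(w)` and `c(x) ≠ y`. -/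
def countErr (c : Classifier d) (w : Vec d) : List (Example d) → Timed ℝ
  | [] => step 0
  | z :: zs => do
      let z ← fetch z
      let s ← vInner z.1 w
      let pos ← leq 0 s
      let b ← classify c z.1
      let bad ← step (pos && (b ^^ z.2))
      let n ← countErr c w zs
      if bad then step (n + 1) else step n

/-- The empirical probability of `x ∈ h(w) ∩ c(x) ≠ y`. -/
def empErr (S : List (Example d)) (c : Classifier d) (w : Vec d) : Timed ℝ := do
  let n ← countErr c w S
  step (n / (S.length : ℝ))

/-- A minimizer of `f` over a list, with its value (`none` for the empty list). -/
def argminList {α : Type} (f : α → Timed ℝ) : List α → Timed (Option (α × ℝ))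
  | [] => pure none
  | a :: as => do
      let r ← f a
      let best ← argminList f as
      match best with
      | none => step (some (a, r))
      | some q => do
          let better ← leq r q.2
          if better then step (some (a, r)) else step (some q)

/-! ### Conditional classification for a finite class -/

/-- Number `T` of iterations, for a class of `m` classifiers. -/
def numIter (d m : ℕ) (ε δ : ℝ) : ℕ :=
  ⌈(4 * (d : ℝ) + Real.log (8 * (m : ℝ) / δ)) / ε ^ 4⌉₊

/-- Number `N` of examples per iteration. -/
def batchSize (d m : ℕ) (ε δ : ℝ) : ℕ :=
  ⌈1600 * Real.log (16 * (numIter d m ε δ : ℝ) * (m : ℝ) / δ) ^ 2 / ε ^ 2⌉₊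

/-- Number of examples for estimating the errors. -/
def validSize (d m : ℕ) (ε δ : ℝ) : ℕ :=
  ⌈Real.log (4 * (m : ℝ) * (numIter d m ε δ : ℝ) / δ) / (2 * ε)⌉₊

/-- Indices of all the examples that the algorithm draws: for each of the two calls of projected
SGD, `N` examples for each of the `T` iterations, and the examples for estimating the errors. -/
abbrev DrawIdx (d m : ℕ) (ε δ : ℝ) : Type :=
  (Bool × Fin (numIter d m ε δ) × Fin (batchSize d m ε δ)) ⊕ Fin (validSize d m ε δ)

/-- The batches for one of the two calls of projected SGD. -/
def batchesOf {m : ℕ} {ε δ : ℝ} (ω : DrawIdx d m ε δ → Example d) (b : Bool) :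
    List (List (Example d)) :=
  List.ofFn fun i => List.ofFn fun j => ω (Sum.inl (b, i, j))

/-- The examples for estimating the errors. -/
def validOf {m : ℕ} {ε δ : ℝ} (ω : DrawIdx d m ε δ → Example d) : List (Example d) :=
  List.ofFn fun i => ω (Sum.inr i)

/-- The body of the loop over the classifiers: relabel the examples, run projected SGD from `w₀`
and from `-w₀`, and keep the iterate `w(c)` with the smallest empirical error. Joining the two lists of iterates
costs the length of the first. -/
def selectorFor (bs₁ bs₂ : List (List (Example d))) (S : List (Example d)) (w₀ : Vec d)
    (c : Classifier d) : Timed (Option (Vec d × ℝ)) := do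
  let ls₁ ← mapList (mapList (relabel c)) bs₁
  let ls₂ ← mapList (mapList (relabel c)) bs₂
  let W₁ ← psgd ls₁ w₀
  let w₀' ← vScale (-1) w₀
  let W₂ ← psgd ls₂ w₀'
  let W ← (⟨W₁ ++ W₂, W₁.length⟩ : Timed (List (Vec d)))
  argminList (empErr S c) W

/-- The pairs `(c, w(c))` for all classifiers of the class. -/
def candidates (bs₁ bs₂ : List (List (Example d))) (S : List (Example d)) (w₀ : Vec d) :
    List (Classifier d) → Timed (List (Classifier d × Vec d))
  | [] => pure []
  | c :: cs => do
      let o ← selectorFor bs₁ bs₂ S w₀ c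
      let rest ← candidates bs₁ bs₂ S w₀ cs
      match o with
      | none => step rest
      | some p => step ((c, p.1) :: rest)

/-- The algorithm for a finite class, given as a list `cs`, with initial vector `w₀`, accuracy `ε`
and confidence `δ`, run on the drawn examples `ω`. The same examples serve all classifiers. Each
draw costs one step. The result is the pair `(c, w(c))` with the smallest empirical error. -/
def ccfc (cs : List (Classifier d)) (w₀ : Vec d) (ε δ : ℝ)
    (ω : DrawIdx d cs.length ε δ → Example d) : Timed (Option (Classifier d × Vec d)) := do
  let ω' ← (⟨ω, Fintype.card (DrawIdx d cs.length ε δ)⟩ :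
    Timed (DrawIdx d cs.length ε δ → Example d))
  let cands ← candidates (batchesOf ω' true) (batchesOf ω' false) (validOf ω') w₀ cs
  let best ← argminList (fun p => empErr (validOf ω') p.1 p.2) cands
  step (best.map Prod.fst)

end Operations

end CondClass

end

noncomputable section

namespace CondClass

open MeasureTheory ProbabilityTheory

/-! Fix a pair `(c, v)` of error at most `ε`. After relabelling by `c`, the gradient `g_w` is the
part of `x` orthogonal to `w`, restricted to the error set of `w`. Cut this set along `h(v)`. The
part inside `h(v)` consists of errors of `v`, so it has mass at most `ε`, and Gaussian tails limit
its contribution to `O(ε log(1/ε))` per unit length of `perp w v`. Outside `h(v)` one has `⟨x, w⟩ ≥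
0 > ⟨x, v⟩`; if `⟨w, v⟩ ≥ 0`, all these points push the gradient away from `v`, and by Gaussian
anti-concentration a set of mass `p` contributes at least `p²/4`. Hence an error above a multiple of
`√ε log(1/ε)` forces `⟨E g, v⟩ ≤ -2ε²` with room for sampling error
(`integral_errorSet_inner_perp_le`, `drift_of_large_error`).

The potential `‖w - v‖²` is at most 2 for whichever start `w₀` or `-w₀` lies on the side of `v`. An
update at a bad iterate changes it by at most `4dβ² - 4βε²`, because the gradient is orthogonal to
`w` and normalization only helps. With the chosen `T` and `β`, `T` bad iterates would make the
potential negative (`exists_not_bad_of_drift`).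

The iterates are random, but each depends only on earlier batches, so the next batch is fresh
(`measureReal_pi_fresh_le`). Since `c` and `v` do not depend on the sample, gradients need to
concentrate only in the single direction `v`; this keeps `N` free of `d` up to logarithms, and `d`
enters `T` through `‖g‖² ≤ 4d`.

The validation set is independent of all iterates and estimates every candidate error within `22√ε`,
for which `M ≈ 1/ε` suffices. Selecting by empirical error then loses at most `44√ε`
(`ccfc_val_of_accurate`). -/

lemma exp_le_one_add_add_sq_mul_exp_abs (a : ℝ) :
    Real.exp a ≤ 1 + a + a ^ 2 * Real.exp |a| := by
  have h := Complex.norm_exp_sub_sum_le_norm_mul_exp (a : ℂ) 2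
  simp only [Finset.sum_range_succ, Finset.sum_range_zero, zero_add, pow_zero, Nat.factorial,
    pow_one, Nat.cast_one, div_one, Complex.norm_real, Real.norm_eq_abs, sq_abs, mul_one] at h
  have h2 : (Complex.exp (a : ℂ) - (1 + (a : ℂ))) = ((Real.exp a - (1 + a) : ℝ) : ℂ) := by
    push_cast; rfl
  rw [h2, Complex.norm_real, Real.norm_eq_abs] at h
  have := le_abs_self (Real.exp a - (1 + a))
  linarith

lemma sq_le_two_mul_exp_abs (a : ℝ) : a ^ 2 ≤ 2 * Real.exp |a| := by
  have := Real.quadratic_le_exp_of_nonneg (abs_nonneg a)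
  rw [sq_abs] at this
  have := abs_nonneg a
  linarith

/-! ### Exponential moments and Chernoff bounds. -/

section Concentration

variable {X ι : Type*} [MeasurableSpace X] [Fintype ι] {μ : Measure X} [IsProbabilityMeasure μ]

/-- Bound on the exponential moments of a variable with an exponentially integrable majorant. -/
lemma integral_exp_mul_le {Y Z : X → ℝ} (hY : Measurable Y) (hYZ : ∀ x, |Y x| ≤ Z x)
    (hint : Integrable (fun x => Real.exp (2 * Z x)) μ)
    (hZ : ∫ x, Real.exp (2 * Z x) ∂μ ≤ 15) {t : ℝ} (ht0 : 0 ≤ t) (ht1 : t ≤ 1) :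
    Integrable (fun x => Real.exp (t * Y x)) μ ∧
      ∫ x, Real.exp (t * Y x) ∂μ ≤ Real.exp (t * ∫ x, Y x ∂μ + 30 * t ^ 2) := by
  have hYint : Integrable Y μ := by
    refine hint.mono' hY.aestronglyMeasurable (.of_forall fun x => ?_)
    have h1 := Real.add_one_le_exp (2 * Z x)
    have := hYZ x
    have := abs_nonneg (Y x)
    rw [Real.norm_eq_abs]; linarith
  -- Second-order expansion of the exponential: one factor `exp Z` pays for `Y²`, another for `exp
  -- |tY|`.
  have hle : ∀ x, Real.exp (t * Y x) ≤ 1 + t * Y x + 2 * t ^ 2 * Real.exp (2 * Z x) := by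
    intro x
    refine (exp_le_one_add_add_sq_mul_exp_abs (t * Y x)).trans ?_
    have h1 : |t * Y x| ≤ Z x := by
      rw [abs_mul, abs_of_nonneg ht0]
      nlinarith [abs_nonneg (Y x), hYZ x]
    have h2 : Y x ^ 2 ≤ 2 * Real.exp (Z x) :=
      (sq_le_two_mul_exp_abs _).trans (by gcongr; exact hYZ x)
    have h3 : (t * Y x) ^ 2 * Real.exp |t * Y x| ≤ t ^ 2 * (2 * Real.exp (Z x)) * Real.exp (Z x) := by
      rw [mul_pow]; gcongr
    have h4 : Real.exp (2 * Z x) = Real.exp (Z x) * Real.exp (Z x) := by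
      rw [← Real.exp_add]; ring_nf
    rw [h4]; linarith
  have hb' : Integrable (fun x => 1 + t * Y x) μ := (integrable_const 1).add (hYint.const_mul t)
  have hb : Integrable (fun x => 1 + t * Y x + 2 * t ^ 2 * Real.exp (2 * Z x)) μ :=
    hb'.add (hint.const_mul _)
  have hint' : Integrable (fun x => Real.exp (t * Y x)) μ :=
    hb.mono' (by fun_prop) (.of_forall fun x => by
      rw [Real.norm_eq_abs, abs_of_pos (Real.exp_pos _)]; exact hle x)
  refine ⟨hint', (integral_mono hint' hb hle).trans ?_⟩
  rw [integral_add hb' (hint.const_mul _),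
    integral_add (integrable_const 1) (hYint.const_mul t), integral_const_mul, integral_const_mul]
  simp only [integral_const, probReal_univ, smul_eq_mul, mul_one]
  have := Real.add_one_le_exp (t * ∫ x, Y x ∂μ + 30 * t ^ 2)
  nlinarith [sq_nonneg t]

/-- Chernoff's bound for sums of independent copies. -/
lemma measureReal_pi_sum_ge_le {f : X → ℝ} {t a : ℝ} (ht : 0 ≤ t)
    (hint : Integrable (fun x => Real.exp (t * f x)) μ)
    (ha : ∫ x, Real.exp (t * f x) ∂μ ≤ Real.exp a) (θ : ℝ) :
    (Measure.pi fun _ : ι => μ).real {x | θ ≤ ∑ j, f (x j)} ≤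
      Real.exp (Fintype.card ι * a - t * θ) := by
  have hprod : ∀ x : ι → X, Real.exp (t * ∑ j, f (x j)) = ∏ j, Real.exp (t * f (x j)) := by
    intro x; rw [Finset.mul_sum, Real.exp_sum]
  have hi : Integrable (fun x : ι → X => Real.exp (t * ∑ j, f (x j))) (Measure.pi fun _ => μ) := by
    simp_rw [hprod]
    exact Integrable.fintype_prod (f := fun _ x => Real.exp (t * f x)) fun _ => hint
  refine (measure_ge_le_exp_mul_mgf θ ht hi).trans ?_
  rw [mgf]
  simp_rw [hprod]
  rw [integral_fintype_prod_eq_pow (fun x => Real.exp (t * f x)), sub_eq_add_neg, add_comm,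
    Real.exp_add, Real.exp_nat_mul, neg_mul]
  gcongr

/-- Deviation bound for sums of independent copies of a variable with an exponentially
integrable majorant. -/
lemma measureReal_pi_sum_ge_mean_add_le {Y Z : X → ℝ} (hY : Measurable Y)
    (hYZ : ∀ x, |Y x| ≤ Z x) (hint : Integrable (fun x => Real.exp (2 * Z x)) μ)
    (hZ : ∫ x, Real.exp (2 * Z x) ∂μ ≤ 15) {η : ℝ} (h0 : 0 ≤ η) (h1 : η ≤ 60) :
    (Measure.pi fun _ : ι => μ).real
      {x | Fintype.card ι * ((∫ x, Y x ∂μ) + η) ≤ ∑ j, Y (x j)} ≤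
      Real.exp (-(Fintype.card ι * η ^ 2 / 120)) := by
  -- The value `η / 60` minimizes the Chernoff exponent `30 t² - t η`.
  obtain ⟨hi, hle⟩ := integral_exp_mul_le hY hYZ hint hZ (t := η / 60) (by positivity) (by linarith)
  refine (measureReal_pi_sum_ge_le (by positivity) hi hle _).trans (le_of_eq ?_)
  congr 1; ring

end Concentration

/-! ### Fresh coordinates of a product measure. -/

section Fubini

variable {X ι κ W : Type*}

/-- Replace the coordinates in the range of `e`. -/
def overwrite (e : κ ↪ ι) (p : (ι → X) × (κ → X)) : ι → X :=
  Function.extend e p.2 p.1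

lemma overwrite_apply (e : κ ↪ ι) (p : (ι → X) × (κ → X)) (k : κ) : overwrite e p (e k) = p.2 k :=
  e.injective.extend_apply _ _ _

lemma overwrite_of_notMem (e : κ ↪ ι) (p : (ι → X) × (κ → X)) {i : ι} (hi : i ∉ Set.range e) :
    overwrite e p i = p.1 i :=
  Function.extend_apply' _ _ _ (by simpa using hi)

variable [MeasurableSpace X] [MeasurableSpace W]

lemma measurable_overwrite (e : κ ↪ ι) : Measurable (overwrite (X := X) e) := by
  refine measurable_pi_iff.2 fun i => ?_
  by_cases hi : i ∈ Set.range e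
  · obtain ⟨k, rfl⟩ := hi
    simp_rw [overwrite_apply]; fun_prop
  · simp_rw [overwrite_of_notMem e _ hi]; fun_prop

variable [Fintype ι] [Fintype κ]

/-- Replacing some coordinates by fresh independent ones does not change the law. -/
lemma measurePreserving_overwrite (μ : Measure X) [IsProbabilityMeasure μ] (e : κ ↪ ι) :
    MeasurePreserving (overwrite e)
      ((Measure.pi fun _ : ι => μ).prod (Measure.pi fun _ : κ => μ)) (Measure.pi fun _ => μ) := by
  classical
  refine ⟨measurable_overwrite e, (Measure.pi_eq fun s hs => ?_).symm⟩
  rw [Measure.map_apply (measurable_overwrite e) (MeasurableSet.univ_pi hs)]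
  -- The law is tested on boxes: the old coordinates in the range of `e` become unconstrained, and
  -- the new ones inherit their constraints.
  have : overwrite e ⁻¹' (Set.univ.pi s) =
      (Set.univ.pi fun i => if i ∈ Set.range e then Set.univ else s i) ×ˢ
        (Set.univ.pi fun k => s (e k)) := by
    ext p
    simp only [Set.mem_preimage, Set.mem_pi, Set.mem_univ, forall_const, Set.mem_prod]
    constructor
    · intro h
      refine ⟨fun i => ?_, fun k => by simpa [overwrite_apply] using h (e k)⟩
      split_ifs with hi
      · trivial
      · simpa [overwrite_of_notMem e p hi] using h i
    · rintro ⟨h1, h2⟩ i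
      by_cases hi : i ∈ Set.range e
      · obtain ⟨k, rfl⟩ := hi
        simpa [overwrite_apply] using h2 k
      · have := h1 i
        rw [if_neg hi] at this
        simpa [overwrite_of_notMem e p hi] using this
  rw [this, Measure.prod_prod, Measure.pi_pi, Measure.pi_pi]
  have hf : ∀ i, μ (if i ∈ Set.range e then Set.univ else s i) =
      if i ∈ Finset.univ.map e then 1 else μ (s i) := by
    intro i; by_cases hi : i ∈ Set.range e
    · rw [if_pos hi, if_pos (by simpa using hi), measure_univ]
    · rw [if_neg hi, if_neg (by simpa using hi)]
  simp_rw [hf]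
  rw [← Finset.prod_map Finset.univ e (fun i => μ (s i)), Finset.prod_ite, Finset.prod_const_one,
    one_mul, ← Finset.prod_filter_mul_prod_filter_not Finset.univ (· ∈ Finset.univ.map e)
      (fun i => μ (s i)), mul_comm]
  congr 1
  refine Finset.prod_congr ?_ fun _ _ => rfl
  ext i; simp

/-- A bound for all sections bounds the probability of an event about fresh coordinates and a
quantity determined by the others. -/
lemma measureReal_pi_fresh_le (μ : Measure X) [IsProbabilityMeasure μ] (e : κ ↪ ι)
    {g : (ι → X) → W} (hg : Measurable g)
    (hloc : ∀ ω ω', (∀ i, i ∉ Set.range e → ω i = ω' i) → g ω = g ω')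
    {A : Set (W × (κ → X))} (hA : MeasurableSet A) {q : ℝ}
    (hq : ∀ w, (Measure.pi fun _ : κ => μ).real {z | (w, z) ∈ A} ≤ q) :
    (Measure.pi fun _ : ι => μ).real {ω | (g ω, fun k => ω (e k)) ∈ A} ≤ q := by
  have hF : Measurable fun ω : ι → X => (g ω, fun k => ω (e k)) := by fun_prop
  have hA' : MeasurableSet {ω : ι → X | (g ω, fun k => ω (e k)) ∈ A} := hF hA
  have hq0 : 0 ≤ q := measureReal_nonneg.trans (hq (g fun _ => (nonempty_of_isProbabilityMeasure μ).some))
  refine ENNReal.toReal_le_of_le_ofReal hq0 ?_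
  -- Redraw the coordinates in the range of `e` independently. By `hloc` this does not affect `g`,
  -- so Fubini reduces the claim to a fixed past.
  rw [← (measurePreserving_overwrite μ e).measure_preimage hA'.nullMeasurableSet,
    Measure.prod_apply ((measurable_overwrite e) hA')]
  calc _ ≤ ∫⁻ _, ENNReal.ofReal q ∂(Measure.pi fun _ : ι => μ) := by
        refine lintegral_mono fun ω => ?_
        have : (Prod.mk ω ⁻¹' (overwrite e ⁻¹' {ω | (g ω, fun k => ω (e k)) ∈ A})) =
            {z | (g ω, z) ∈ A} := by
          ext z
          simp only [Set.mem_preimage, Set.mem_ofPred_eq]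
          rw [hloc (overwrite e (ω, z)) ω fun i hi => overwrite_of_notMem e _ hi]
          simp_rw [overwrite_apply]
        rw [this, ← ofReal_measureReal]
        exact ENNReal.ofReal_le_ofReal (hq _)
    _ = ENNReal.ofReal q := by simp

end Fubini

/-! ### Moments, tails and anti-concentration of the Gaussian marginal. -/

lemma stdGaussian_map_inner {d : ℕ} {u : Vec d} (hu : ‖u‖ = 1) :
    (stdGaussian (Vec d)).map (fun x => inner ℝ x u) = gaussianReal 0 1 := by
  have h := IsGaussian.map_eq_gaussianReal (μ := stdGaussian (Vec d)) (innerSL ℝ u)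
  rw [integral_strongDual_stdGaussian, variance_dual_stdGaussian, innerSL_apply_norm, hu] at h
  simp only [one_pow, Real.toNNReal_one] at h
  rw [← h]
  congr 1; ext x; simp [real_inner_comm]

section Gaussian

variable {d : ℕ} {D : Measure (Example d)}

lemma map_inner_fst (hD : D.fst = stdGaussian (Vec d)) {u : Vec d} (hu : ‖u‖ = 1) :
    D.map (fun z => inner ℝ z.1 u) = gaussianReal 0 1 := by
  rw [← stdGaussian_map_inner hu, ← hD, Measure.fst, Measure.map_map (by fun_prop) (by fun_prop)]
  rfl

lemma integral_exp_sq_gaussianReal :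
    Integrable (fun z => Real.exp (1 / 4 * z ^ 2)) (gaussianReal 0 1) ∧
      ∫ z, Real.exp (1 / 4 * z ^ 2) ∂(gaussianReal 0 1) = √2 := by
  have hpdf : ∀ z : ℝ, gaussianPDFReal 0 1 z * Real.exp (1 / 4 * z ^ 2) =
      (√(2 * Real.pi))⁻¹ * Real.exp (-(1 / 4) * z ^ 2) := by
    intro z
    rw [gaussianPDFReal, mul_assoc, ← Real.exp_add]
    simp only [NNReal.coe_one, mul_one, sub_zero]
    congr 2; ring
  have hg := integrable_exp_neg_mul_sq (b := 1 / 4) (by norm_num)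
  constructor
  · rw [gaussianReal_of_var_ne_zero _ one_ne_zero,
      integrable_withDensity_iff_integrable_smul' (measurable_gaussianPDF 0 1)
        (.of_forall fun _ => gaussianPDF_lt_top)]
    simp only [toReal_gaussianPDF, smul_eq_mul, hpdf]
    exact hg.const_mul _
  · rw [integral_gaussianReal_eq_integral_smul one_ne_zero]
    simp only [smul_eq_mul, hpdf]
    rw [integral_const_mul, integral_gaussian, ← Real.sqrt_inv, ← Real.sqrt_mul (by positivity)]
    congr 1
    field_simp
    norm_num

lemma integral_exp_norm_sq (hD : D.fst = stdGaussian (Vec d)) :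
    Integrable (fun z => Real.exp (1 / 4 * ‖z.1‖ ^ 2)) D ∧
      ∫ z, Real.exp (1 / 4 * ‖z.1‖ ^ 2) ∂D ≤ Real.exp (d / 2) := by
  obtain ⟨h1, h2⟩ := integral_exp_sq_gaussianReal
  have hn : ∀ x : Fin d → ℝ, Real.exp (1 / 4 * ‖(WithLp.toLp 2 x : Vec d)‖ ^ 2) =
      ∏ i, Real.exp (1 / 4 * x i ^ 2) := by
    intro x
    rw [EuclideanSpace.norm_sq_eq, Finset.mul_sum, Real.exp_sum]
    simp
  have hi : Integrable (fun x : Vec d => Real.exp (1 / 4 * ‖x‖ ^ 2)) (stdGaussian (Vec d)) := by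
    rw [← map_pi_eq_stdGaussian, integrable_map_measure (by fun_prop) (by fun_prop)]
    simp only [Function.comp_def, hn]
    exact Integrable.fintype_prod (f := fun _ x => Real.exp (1 / 4 * x ^ 2)) fun _ => h1
  have he : ∫ x : Vec d, Real.exp (1 / 4 * ‖x‖ ^ 2) ∂(stdGaussian (Vec d)) = √2 ^ d := by
    rw [← map_pi_eq_stdGaussian, integral_map (by fun_prop) (by fun_prop)]
    simp only [hn]
    rw [integral_fintype_prod_eq_pow (fun x => Real.exp (1 / 4 * x ^ 2)), h2, Fintype.card_fin]
  rw [← hD, Measure.fst] at hi he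
  rw [integral_map (by fun_prop) (by fun_prop)] at he
  refine ⟨hi.comp_measurable (by fun_prop), he.trans_le ?_⟩
  have : Real.exp (d / 2) = Real.exp (1 / 2) ^ d := by
    rw [← Real.exp_nat_mul]; congr 1; ring
  rw [this]
  gcongr
  apply Real.sqrt_le_iff.2 ⟨(Real.exp_pos _).le, ?_⟩
  rw [← Real.exp_nat_mul]
  norm_num
  linarith [Real.exp_one_gt_d9]

lemma integral_exp_abs_gaussianReal_le (t : ℝ) :
    Integrable (fun z => Real.exp (t * |z|)) (gaussianReal 0 1) ∧
      ∫ z, Real.exp (t * |z|) ∂(gaussianReal 0 1) ≤ 2 * Real.exp (t ^ 2 / 2) := by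
  have hp := integrable_exp_mul_gaussianReal (μ := 0) (v := 1) t
  have hm := integrable_exp_mul_gaussianReal (μ := 0) (v := 1) (-t)
  have hle : ∀ z : ℝ, Real.exp (t * |z|) ≤ Real.exp (t * z) + Real.exp (-t * z) := by
    intro z
    rcases abs_cases z with ⟨h, -⟩ | ⟨h, -⟩ <;> rw [h]
    · linarith [Real.exp_pos (-t * z)]
    · rw [mul_neg, neg_mul]; linarith [Real.exp_pos (t * z)]
  have hi : Integrable (fun z => Real.exp (t * |z|)) (gaussianReal 0 1) :=
    (hp.add hm).mono' (by fun_prop) (.of_forall fun z => by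
      rw [Real.norm_eq_abs, abs_of_pos (Real.exp_pos _)]; exact hle z)
  refine ⟨hi, (integral_mono hi (hp.add hm) hle).trans ?_⟩
  have h := mgf_fun_id_gaussianReal (μ := 0) (v := 1)
  have h1 := congrFun h t
  have h2 := congrFun h (-t)
  simp only [mgf] at h1 h2
  simp only [Pi.add_apply]
  rw [integral_add hp hm, h1, h2]
  apply le_of_eq
  simp only [zero_mul, NNReal.coe_one, one_mul, zero_add, even_two, Even.neg_pow]
  ring

lemma integral_exp_abs_inner_le (hD : D.fst = stdGaussian (Vec d)) {u : Vec d} (hu : ‖u‖ = 1)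
    (t : ℝ) : Integrable (fun z => Real.exp (t * |inner ℝ z.1 u|)) D ∧
      ∫ z, Real.exp (t * |inner ℝ z.1 u|) ∂D ≤ 2 * Real.exp (t ^ 2 / 2) := by
  obtain ⟨h1, h2⟩ := integral_exp_abs_gaussianReal_le t
  rw [← map_inner_fst hD hu] at h1 h2
  rw [integral_map (by fun_prop) (by fun_prop)] at h2
  exact ⟨h1.comp_measurable (by fun_prop), h2⟩

/-- Anti-concentration of a standard Gaussian. -/
lemma measureReal_abs_inner_le (hD : D.fst = stdGaussian (Vec d)) {u : Vec d} (hu : ‖u‖ = 1)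
    {r : ℝ} (hr : 0 ≤ r) : D.real {z | |inner ℝ z.1 u| ≤ r} ≤ r := by
  have hs : MeasurableSet {y : ℝ | |y| ≤ r} := measurableSet_le (by fun_prop) (by fun_prop)
  have h : D.real {z | |inner ℝ z.1 u| ≤ r} = (gaussianReal 0 1).real {y | |y| ≤ r} := by
    rw [← map_inner_fst hD hu, map_measureReal_apply (by fun_prop) hs]
    rfl
  rw [h]
  refine ENNReal.toReal_le_of_le_ofReal hr ?_
  rw [gaussianReal_apply _ one_ne_zero]
  calc _ ≤ ∫⁻ _ in {y : ℝ | |y| ≤ r}, ENNReal.ofReal (1 / 2) := by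
        refine lintegral_mono fun y => ENNReal.ofReal_le_ofReal ?_
        rw [gaussianPDFReal]
        have h2 : 2 ≤ √(2 * Real.pi * (1 : NNReal)) := by
          apply Real.le_sqrt_of_sq_le
          simp only [NNReal.coe_one]; linarith [Real.pi_gt_three]
        have h3 : (√(2 * Real.pi * (1 : NNReal)))⁻¹ ≤ 1 / 2 := by
          rw [one_div]; gcongr
        have h4 : Real.exp (-(y - 0) ^ 2 / (2 * (1 : NNReal))) ≤ 1 := by
          apply Real.exp_le_one_iff.2
          have := sq_nonneg (y - 0)
          simp only [NNReal.coe_one]; linarith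
        exact (mul_le_mul h3 h4 (Real.exp_pos _).le (by norm_num)).trans_eq (mul_one _)
    _ = ENNReal.ofReal r := by
        have : {y : ℝ | |y| ≤ r} = Set.Icc (-r) r := by ext y; simp [abs_le]
        rw [setLIntegral_const, this, Real.volume_Icc, ← ENNReal.ofReal_mul (by norm_num)]
        congr 1; ring

lemma integral_exp_abs_inner_le_four (hD : D.fst = stdGaussian (Vec d)) {u : Vec d}
    (hu : ‖u‖ = 1) : Integrable (fun z => Real.exp |inner ℝ z.1 u|) D ∧
      ∫ z, Real.exp |inner ℝ z.1 u| ∂D ≤ 4 := by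
  obtain ⟨h1, h2⟩ := integral_exp_abs_inner_le hD hu 1
  simp only [one_mul] at h1 h2
  refine ⟨h1, h2.trans ?_⟩
  have : Real.exp (1 ^ 2 / 2) ≤ 2 := by
    have h : Real.exp (1 ^ 2 / 2) * Real.exp (1 ^ 2 / 2) = Real.exp 1 := by
      rw [← Real.exp_add]; norm_num
    nlinarith [Real.exp_one_lt_d9, Real.exp_pos (1 ^ 2 / 2)]
  linarith

lemma integral_exp_two_mul_abs_inner_le (hD : D.fst = stdGaussian (Vec d)) {u : Vec d}
    (hu : ‖u‖ = 1) : Integrable (fun z => Real.exp (2 * |inner ℝ z.1 u|)) D ∧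
      ∫ z, Real.exp (2 * |inner ℝ z.1 u|) ∂D ≤ 15 := by
  obtain ⟨h1, h2⟩ := integral_exp_abs_inner_le hD hu 2
  refine ⟨h1, h2.trans ?_⟩
  have h : Real.exp (2 ^ 2 / 2) = Real.exp 1 * Real.exp 1 := by
    rw [← Real.exp_add]; norm_num
  rw [h]
  nlinarith [Real.exp_one_lt_d9, Real.exp_pos 1]

lemma integrable_abs_inner (hD : D.fst = stdGaussian (Vec d)) {u : Vec d} (hu : ‖u‖ = 1) :
    Integrable (fun z => |inner ℝ z.1 u|) D := by
  refine (integral_exp_abs_inner_le_four hD hu).1.mono' (by fun_prop) (.of_forall fun z => ?_)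
  rw [Real.norm_eq_abs, abs_abs]
  linarith [Real.add_one_le_exp |inner ℝ z.1 u|]

variable [IsProbabilityMeasure D]

lemma measureReal_le_abs_inner (hD : D.fst = stdGaussian (Vec d)) {u : Vec d} (hu : ‖u‖ = 1)
    (L : ℝ) : D.real {z | L ≤ |inner ℝ z.1 u|} ≤ 4 * Real.exp (-L) := by
  obtain ⟨h1, h2⟩ := integral_exp_abs_inner_le_four hD hu
  have h := measure_ge_le_exp_mul_mgf (μ := D) (X := fun z => |inner ℝ z.1 u|) (t := 1) L zero_le_one
    (by simpa using h1)
  simp only [mgf, one_mul, neg_mul] at h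
  refine h.trans ?_
  rw [mul_comm]; gcongr

/-- The mean squared norm of a sample of standard Gaussian vectors. -/
lemma measureReal_pi_sum_norm_sq_ge_le {ι : Type*} [Fintype ι]
    (hD : D.fst = stdGaussian (Vec d)) :
    (Measure.pi fun _ : ι => D).real {z | Fintype.card ι * (4 * d : ℝ) ≤ ∑ j, ‖(z j).1‖ ^ 2} ≤
      Real.exp (-(Fintype.card ι * d / 2 : ℝ)) := by
  obtain ⟨h1, h2⟩ := integral_exp_norm_sq hD
  -- Chernoff at parameter 1/4: per example the moment costs `d/2` and the threshold `4d` gains `d`.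
  refine (measureReal_pi_sum_ge_le (by norm_num) h1 h2 _).trans (le_of_eq ?_)
  congr 1; ring

end Gaussian

/-! ### Halfspaces and the drift of the expected gradient. -/

section Geometry

variable {d : ℕ}

/-- The component of `v` orthogonal to `w`, for a unit vector `w`. -/
def perp (w v : Vec d) : Vec d := v - inner ℝ w v • w

lemma inner_perp (x w v : Vec d) :
    inner ℝ x (perp w v) = inner ℝ x v - inner ℝ w v * inner ℝ x w := by
  rw [perp, inner_sub_right, inner_smul_right]

lemma norm_perp_sq {w v : Vec d} (hw : ‖w‖ = 1) (hv : ‖v‖ = 1) :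
    ‖perp w v‖ ^ 2 = 1 - inner ℝ w v ^ 2 := by
  rw [perp, norm_sub_sq_real, norm_smul, hw, hv, inner_smul_right, real_inner_comm,
    Real.norm_eq_abs, mul_one, sq_abs]
  ring

/-- With `t = ⟨w, v⟩` in `[0, 1]` this reads `2 - 2t ≤ 2(1 - t²)`. It turns a lower bound on the
distance to `v` into one on `‖perp w v‖`. -/
lemma norm_sub_sq_le_two_mul_norm_perp_sq {w v : Vec d} (hw : ‖w‖ = 1) (hv : ‖v‖ = 1)
    (h : 0 ≤ inner ℝ w v) : ‖v - w‖ ^ 2 ≤ 2 * ‖perp w v‖ ^ 2 := by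
  have h1 := real_inner_le_norm w v
  rw [hw, hv] at h1
  rw [norm_perp_sq hw hv, norm_sub_sq_real, hw, hv, real_inner_comm]
  nlinarith

lemma measurableSet_errorSet_uncurry {c : Classifier d} (hc : Measurable c) :
    MeasurableSet {p : Vec d × Example d | p.2 ∈ errorSet c p.1} := by
  have h1 : MeasurableSet {p : Vec d × Example d | (0 : ℝ) ≤ inner ℝ p.2.1 p.1} :=
    measurableSet_le (by fun_prop) (by fun_prop)
  have h2 : MeasurableSet {p : Vec d × Example d | c p.2.1 ≠ p.2.2} :=
    (measurableSet_eq_fun (hc.comp (by fun_prop : Measurable fun p : Vec d × Example d => p.2.1))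
      (by fun_prop)).compl
  exact h1.inter h2

lemma measurableSet_errorSet {c : Classifier d} (hc : Measurable c) (w : Vec d) :
    MeasurableSet (errorSet c w) :=
  measurable_prodMk_left (x := w) (measurableSet_errorSet_uncurry hc)

variable {D : Measure (Example d)} [IsProbabilityMeasure D]

/-- The mass between two close halfspaces is small. -/
lemma measureReal_halfspace_diff_le (hD : D.fst = stdGaussian (Vec d)) {w v : Vec d}
    (hw : ‖w‖ = 1) {L : ℝ} (hL : 0 ≤ L) :
    D.real {z | 0 ≤ inner ℝ z.1 w ∧ inner ℝ z.1 v < 0} ≤ ‖v - w‖ * L + 4 * Real.exp (-L) := by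
  rcases eq_or_ne v w with rfl | hne
  · have : {z : Example d | 0 ≤ inner ℝ z.1 v ∧ inner ℝ z.1 v < 0} = ∅ := by
      ext z; simp
    rw [this]
    simp; positivity
  have hr : 0 < ‖v - w‖ := norm_pos_iff.2 (sub_ne_zero.2 hne)
  have he : ‖‖v - w‖⁻¹ • (v - w)‖ = 1 := by
    rw [norm_smul, norm_inv, norm_norm, inv_mul_cancel₀ hr.ne']
  -- Between the halfspaces `0 ≤ ⟨x, w⟩ < ⟨x, w - v⟩`, so either `⟨x, w⟩` is small or `x` is long in
  -- the direction `v - w`.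
  have hsub : {z : Example d | 0 ≤ inner ℝ z.1 w ∧ inner ℝ z.1 v < 0} ⊆
      {z | |inner ℝ z.1 w| ≤ ‖v - w‖ * L} ∪ {z | L ≤ |inner ℝ z.1 (‖v - w‖⁻¹ • (v - w))|} := by
    rintro z ⟨h1, h2⟩
    by_cases h3 : L ≤ |inner ℝ z.1 (‖v - w‖⁻¹ • (v - w))|
    · exact Or.inr h3
    · refine Or.inl ?_
      push Not at h3
      rw [inner_smul_right, inner_sub_right] at h3
      have h4 := neg_lt_of_abs_lt h3
      have h5 : inner ℝ z.1 v - inner ℝ z.1 w =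
          ‖v - w‖ * (‖v - w‖⁻¹ * (inner ℝ z.1 v - inner ℝ z.1 w)) := by
        field_simp
      have h6 := mul_lt_mul_of_pos_left h4 hr
      change |inner ℝ z.1 w| ≤ _
      rw [abs_of_nonneg h1]
      linarith
  calc _ ≤ D.real {z | |inner ℝ z.1 w| ≤ ‖v - w‖ * L} +
        D.real {z | L ≤ |inner ℝ z.1 (‖v - w‖⁻¹ • (v - w))|} :=
        (measureReal_mono hsub).trans (measureReal_union_le _ _)
    _ ≤ _ := add_le_add (measureReal_abs_inner_le hD hw (by positivity))
        (measureReal_le_abs_inner hD he L)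

lemma measureReal_errorSet_le_add (c : Classifier d) (w v : Vec d) :
    D.real (errorSet c w) ≤
      D.real (errorSet c v) + D.real {z | 0 ≤ inner ℝ z.1 w ∧ inner ℝ z.1 v < 0} := by
  refine (measureReal_mono ?_).trans (measureReal_union_le _ _)
  rintro z ⟨h1, h2⟩
  rcases le_or_gt 0 (inner ℝ z.1 v) with h | h
  · exact Or.inl ⟨h, h2⟩
  · exact Or.inr ⟨h1, h⟩

/-- A set of mass `p` carries at least `p² / 4` of the first absolute moment. -/
lemma sq_div_four_le_integral_indicator (hD : D.fst = stdGaussian (Vec d)) {u : Vec d}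
    (hu : ‖u‖ = 1) {B : Set (Example d)} (hB : MeasurableSet B) {p : ℝ} (hp : 0 ≤ p)
    (hpB : p ≤ D.real B) : p ^ 2 / 4 ≤ ∫ z, B.indicator (fun z => |inner ℝ z.1 u|) z ∂D := by
  have hS : MeasurableSet {z : Example d | |inner ℝ z.1 u| ≤ p / 2} :=
    measurableSet_le (by fun_prop) (by fun_prop)
  have i1 : Integrable (B.indicator fun _ => p / 2) D := (integrable_const _).indicator hB
  have i2 : Integrable (({z : Example d | |inner ℝ z.1 u| ≤ p / 2}).indicator fun _ => p / 2) D :=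
    (integrable_const _).indicator hS
  -- Points of `B` outside the strip `|⟨x, u⟩| ≤ p/2` count at least `p/2` each, and the strip has
  -- mass at most `p/2`.
  have h := integral_mono (i1.sub i2) ((integrable_abs_inner hD hu).indicator hB) (fun z => by
    simp only [Pi.sub_apply]
    by_cases h1 : z ∈ B <;> by_cases h2 : z ∈ {z : Example d | |inner ℝ z.1 u| ≤ p / 2}
    · simp [h1, h2]
    · simp only [h1, h2, Set.indicator_of_mem, Set.indicator_of_notMem, not_false_eq_true, sub_zero]
      exact (not_le.1 h2).le
    · simp only [h1, h2, Set.indicator_of_mem, Set.indicator_of_notMem, not_false_eq_true]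
      linarith
    · simp [h1, h2])
  simp only [Pi.sub_apply] at h
  rw [integral_sub i1 i2, integral_indicator_const _ hB, integral_indicator_const _ hS,
    smul_eq_mul, smul_eq_mul] at h
  have h3 := measureReal_abs_inner_le hD hu (r := p / 2) (by positivity)
  nlinarith

/-- A set of mass `m` carries at most `m L + 4 exp (-L)` of the first absolute moment. -/
lemma integral_indicator_abs_inner_le (hD : D.fst = stdGaussian (Vec d)) {u : Vec d}
    (hu : ‖u‖ = 1) {A : Set (Example d)} (hA : MeasurableSet A) (L : ℝ) :
    ∫ z, A.indicator (fun z => |inner ℝ z.1 u|) z ∂D ≤ D.real A * L + 4 * Real.exp (-L) := by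
  obtain ⟨j1, j2⟩ := integral_exp_abs_inner_le_four hD hu
  have i1 : Integrable (A.indicator fun _ => L) D := (integrable_const _).indicator hA
  have i2 := j1.const_mul (Real.exp (-L))
  -- On `A` the pointwise bound is `a ≤ L + exp (a - L)`.
  have h := integral_mono ((integrable_abs_inner hD hu).indicator hA) (i1.add i2) (fun z => by
    simp only [Pi.add_apply]
    by_cases h1 : z ∈ A
    · simp only [h1, Set.indicator_of_mem]
      rw [← Real.exp_add]
      linarith [Real.add_one_le_exp (-L + |inner ℝ z.1 u|)]
    · simp only [h1, Set.indicator_of_notMem, not_false_eq_true]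
      positivity)
  simp only [Pi.add_apply] at h
  rw [integral_add i1 i2, integral_indicator_const _ hA, integral_const_mul, smul_eq_mul] at h
  refine h.trans ?_
  rw [mul_comm 4]; gcongr

/-- The expected projected gradient points away from any halfspace of small error at an angle of
at most `π / 2`. -/
lemma integral_errorSet_inner_perp_le (hD : D.fst = stdGaussian (Vec d)) {c : Classifier d}
    (hc : Measurable c) {w v : Vec d} (hwv : 0 ≤ inner ℝ w v) {ε : ℝ}
    (hv : D.real (errorSet c v) ≤ ε) (hbad : ε ≤ D.real (errorSet c w)) {L : ℝ} (hL : 0 ≤ L) :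
    ∫ z, (errorSet c w).indicator (fun z => inner ℝ z.1 (perp w v)) z ∂D ≤
      ‖perp w v‖ * (ε * L + 4 * Real.exp (-L) - (D.real (errorSet c w) - ε) ^ 2 / 4) := by
  rcases (norm_nonneg (perp w v)).eq_or_lt with h0 | hs
  · have : perp w v = 0 := norm_eq_zero.1 h0.symm
    simp [this]
  set s := ‖perp w v‖ with hsdef
  set u := s⁻¹ • perp w v with hudef
  have hu : ‖u‖ = 1 := by
    rw [hudef, norm_smul, norm_inv, hsdef, norm_norm, inv_mul_cancel₀ hs.ne']
  have hpu : perp w v = s • u := by rw [hudef, smul_smul, mul_inv_cancel₀ hs.ne', one_smul]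
  set A : Set (Example d) := errorSet c w ∩ {z | 0 ≤ inner ℝ z.1 v}
  set B : Set (Example d) := errorSet c w \ {z | 0 ≤ inner ℝ z.1 v}
  have hH : MeasurableSet {z : Example d | (0 : ℝ) ≤ inner ℝ z.1 v} :=
    measurableSet_le (by fun_prop) (by fun_prop)
  have hA : MeasurableSet A := (measurableSet_errorSet hc w).inter hH
  have hB : MeasurableSet B := (measurableSet_errorSet hc w).diff hH
  have hAε : D.real A ≤ ε :=
    (measureReal_mono fun z hz => (⟨hz.2, hz.1.2⟩ : z ∈ errorSet c v)).trans hv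
  have hBp : D.real (errorSet c w) - ε ≤ D.real B := by
    have : D.real A + D.real B = D.real (errorSet c w) := measureReal_inter_add_sdiff hH
    linarith
  have h1 := integral_indicator_abs_inner_le hD hu hA L
  have h2 := sq_div_four_le_integral_indicator hD hu hB (by linarith) hBp
  have iA := (integrable_abs_inner hD hu).indicator hA
  have iB := (integrable_abs_inner hD hu).indicator hB
  have h3 : ∫ z, (errorSet c w).indicator (fun z => inner ℝ z.1 u) z ∂D ≤
      ∫ z, A.indicator (fun z => |inner ℝ z.1 u|) z ∂D -
        ∫ z, B.indicator (fun z => |inner ℝ z.1 u|) z ∂D := by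
    rw [← integral_sub iA iB]
    refine integral_mono ?_ (iA.sub iB) fun z => ?_
    · refine Integrable.indicator ?_ (measurableSet_errorSet hc w)
      exact (integrable_norm_iff (by fun_prop)).1 (integrable_abs_inner hD hu)
    simp only
    by_cases hz : z ∈ errorSet c w
    · rw [Set.indicator_of_mem hz]
      rcases le_or_gt 0 (inner ℝ z.1 v) with h | h
      · have hzA : z ∈ A := ⟨hz, h⟩
        have hzB : z ∉ B := fun h' => h'.2 h
        rw [Set.indicator_of_mem hzA, Set.indicator_of_notMem hzB, sub_zero]
        exact le_abs_self _
      · have hzA : z ∉ A := fun h' => h.not_ge h'.2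
        have hzB : z ∈ B := ⟨hz, h.not_ge⟩
        rw [Set.indicator_of_notMem hzA, Set.indicator_of_mem hzB, zero_sub]
        have h4 := inner_perp z.1 w v
        rw [hpu, inner_smul_right] at h4
        have h5 : (0 : ℝ) ≤ inner ℝ z.1 w := hz.1
        -- Here `⟨w, v⟩ ≥ 0` is essential: `⟨x, perp w v⟩ = ⟨x, v⟩ - ⟨w, v⟩⟨x, w⟩` is a negative
        -- term minus a nonnegative one.
        have h6 : s * inner ℝ z.1 u ≤ 0 := by nlinarith
        rw [abs_of_nonpos (by nlinarith), neg_neg]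
    · rw [Set.indicator_of_notMem hz, Set.indicator_of_notMem (fun h => hz h.1),
        Set.indicator_of_notMem (fun h => hz h.1), sub_zero]
  have h4 : ∀ z, (errorSet c w).indicator (fun z => inner ℝ z.1 (perp w v)) z =
      s * (errorSet c w).indicator (fun z => inner ℝ z.1 u) z := by
    intro z
    rw [hpu]
    by_cases hz : z ∈ errorSet c w
    · rw [Set.indicator_of_mem hz, Set.indicator_of_mem hz, inner_smul_right]
    · rw [Set.indicator_of_notMem hz, Set.indicator_of_notMem hz, mul_zero]
  simp_rw [h4]
  rw [integral_const_mul]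
  gcongr
  have := mul_le_mul_of_nonneg_right hAε hL
  linarith

/-- At a vector of large error, the expected projected gradient has a definite component away
from any halfspace of small error, even after a perturbation. -/
lemma drift_of_large_error (hD : D.fst = stdGaussian (Vec d)) {c : Classifier d}
    (hc : Measurable c) {w v : Vec d} (hw : ‖w‖ = 1) (hv1 : ‖v‖ = 1) (hwv : 0 ≤ inner ℝ w v)
    {ε : ℝ} (hε : 0 < ε) (hε1 : ε ≤ 1 / Real.exp 1) (hv : D.real (errorSet c v) ≤ ε)
    (hbad : 11 * √ε * Real.log (1 / ε) < D.real (errorSet c w)) :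
    0 < ‖perp w v‖ ∧
    ∫ z, (errorSet c w).indicator (fun z => inner ℝ z.1 (perp w v)) z ∂D + ‖perp w v‖ * ε ≤
      -(2 * ε ^ 2) := by
  set L := Real.log (1 / ε) with hLdef
  have hexp : Real.exp (-L) = ε := by
    rw [hLdef, one_div, Real.log_inv, neg_neg, Real.exp_log hε]
  have hL : 1 ≤ L := by
    rw [hLdef, Real.le_log_iff_exp_le (by positivity)]
    rwa [le_div_iff₀ hε, mul_comm, ← le_div_iff₀ (Real.exp_pos 1)]
  have hε2 : ε ≤ 1 := hε1.trans (by
    rw [div_le_one (Real.exp_pos 1)]; linarith [Real.exp_one_gt_d9])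
  set q := √ε with hq
  have hqε : q * q = ε := Real.mul_self_sqrt hε.le
  have hq0 : 0 < q := Real.sqrt_pos.2 hε
  have hq1 : q ≤ 1 := Real.sqrt_le_one.2 hε2
  set E := D.real (errorSet c w)
  have h10 : ε ≤ q := hqε ▸ mul_le_of_le_one_left hq0.le hq1
  have hqL : ε ≤ q * L := h10.trans (le_mul_of_one_le_right hq0.le hL)
  have h1 := integral_errorSet_inner_perp_le hD hc hwv hv (by linarith) (L := L) (by linarith)
  have h2 := measureReal_errorSet_le_add (D := D) c w v
  have h3 := measureReal_halfspace_diff_le hD (w := w) (v := v) hw (L := L) (by linarith)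
  rw [hexp] at h1 h3
  have h4 := norm_sub_sq_le_two_mul_norm_perp_sq hw hv1 hwv
  set r := ‖v - w‖
  set s := ‖perp w v‖
  have hs0 : 0 ≤ s := norm_nonneg _
  -- The error of `w` is at most `ε + rL + 4ε ≤ rL + 5qL`, so the threshold `11qL` leaves `6qL` for
  -- `rL`.
  have hr : 6 * q ≤ r := by
    have : 6 * q * L ≤ r * L := by linarith
    exact le_of_mul_le_mul_right this (by linarith)
  have hs : 3 * q ≤ s := by
    by_contra h
    push Not at h
    have h11 : s * s < 3 * q * (3 * q) := mul_self_lt_mul_self hs0 h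
    have h12 : 6 * q * (6 * q) ≤ r * r := mul_self_le_mul_self (by positivity) hr
    linarith [mul_pos hq0 hq0]
  refine ⟨by linarith, ?_⟩
  have h5 : 10 * (q * L) ≤ E - ε := by linarith
  have h6 : 100 * (ε * L ^ 2) ≤ (E - ε) ^ 2 := by
    calc 100 * (ε * L ^ 2) = (10 * (q * L)) ^ 2 := by rw [← hqε]; ring
      _ ≤ _ := by gcongr
  have h7 : L ≤ L ^ 2 := le_self_pow₀ hL two_ne_zero
  have h13 : 1 ≤ L ^ 2 := hL.trans h7
  have h8 : ε * L + 4 * ε - (E - ε) ^ 2 / 4 + ε ≤ -ε := by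
    have : ε * L ≤ ε * L ^ 2 := by gcongr
    have : ε * 1 ≤ ε * L ^ 2 := by gcongr
    linarith
  have h9 : s * (ε * L + 4 * ε - (E - ε) ^ 2 / 4 + ε) ≤ s * -ε := by gcongr
  -- The bracket in `h9` is at most `-ε`; the remaining factor comes from `s ≥ 3√ε ≥ 3ε`.
  have h14 : 3 * ε * ε ≤ s * ε := by gcongr; linarith
  nlinarith

end Geometry

/-! ### Values and step counts of the timed programs. -/

namespace Timed

variable {α γ : Type}

@[simp] lemma val_bind (m : Timed α) (f : α → Timed γ) : (m >>= f).val = (f m.val).val := rfl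

@[simp] lemma steps_bind (m : Timed α) (f : α → Timed γ) :
    (m >>= f).steps = m.steps + (f m.val).steps := rfl

@[simp] lemma val_pure (a : α) : (pure a : Timed α).val = a := rfl

@[simp] lemma steps_pure (a : α) : (pure a : Timed α).steps = 0 := rfl

end Timed

section Values

variable {α γ : Type} {d : ℕ}

@[simp] lemma val_step (a : α) : (step a).val = a := rfl

@[simp] lemma steps_step (a : α) : (step a).steps = 1 := rfl

/-- The label `1[c(x) ≠ y]`. -/
def relabeled (c : Classifier d) (z : Example d) : Example d := (z.1, c z.1 ^^ z.2)

/-- The projected gradient as a function. -/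
def gradVec (w : Vec d) (z : Example d) : Vec d :=
  if z.2 = true ∧ 0 ≤ inner ℝ z.1 w then
    z.1 + (-(inner ℝ z.1 (‖w‖⁻¹ • w))) • (‖w‖⁻¹ • w)
  else 0

/-- The update of projected SGD as a function. -/
def psgdStep (β : ℝ) (batch : List (Example d)) (w : Vec d) : Vec d :=
  ‖w + (-(β / (batch.length : ℝ))) • (batch.map (gradVec w)).sum‖⁻¹ •
    (w + (-(β / (batch.length : ℝ))) • (batch.map (gradVec w)).sum)

/-- The iterates of projected SGD on a sequence of batches. -/
def psgdIter (β : ℝ) (B : ℕ → List (Example d)) (w₀ : Vec d) : ℕ → Vec d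
  | 0 => w₀
  | i + 1 => psgdStep β (B i) (psgdIter β B w₀ i)

lemma val_leq_eq_true_iff (a b : ℝ) : (leq a b).val = true ↔ a ≤ b := by
  simp [leq]

lemma steps_leq (a b : ℝ) : (leq a b).steps = 1 := rfl

lemma val_projGrad (w : Vec d) (z : Example d) : (projGrad w z).val = gradVec w z := by
  simp only [projGrad, Timed.val_bind]
  split_ifs with h
  all_goals
    rw [val_step, Bool.and_eq_true, val_leq_eq_true_iff] at h
    simp only [fetch, vInner, val_step] at h
  · rw [gradVec, if_pos h]
    rfl
  · rw [gradVec, if_neg h]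
    rfl

lemma steps_projGrad_le (w : Vec d) (z : Example d) : (projGrad w z).steps ≤ 11 := by
  simp only [projGrad, Timed.steps_bind]
  split_ifs
  all_goals
    simp only [fetch, vInner, steps_leq, vNormalize, vNorm, vScale, vAdd, Timed.steps_bind,
      steps_step]
    norm_num

lemma val_sumGrad (w : Vec d) (l : List (Example d)) :
    (sumGrad w l).val = (l.map (gradVec w)).sum := by
  induction l with
  | nil => rfl
  | cons z l ih => simp [sumGrad, vAdd, ih, val_projGrad]

lemma steps_sumGrad_le (w : Vec d) (l : List (Example d)) :
    (sumGrad w l).steps ≤ 12 * l.length + 1 := by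
  induction l with
  | nil => simp [sumGrad]
  | cons z l ih =>
    have := steps_projGrad_le w z
    simp only [sumGrad, vAdd, Timed.steps_bind, steps_step, List.length_cons]
    omega

lemma val_psgdUpdate (β : ℝ) (l : List (Example d)) (w : Vec d) :
    (psgdUpdate β l w).val = psgdStep β l w := by
  simp [psgdUpdate, psgdStep, vNormalize, vScale, vAdd, vNorm, val_sumGrad]

lemma steps_psgdUpdate_le (β : ℝ) (l : List (Example d)) (w : Vec d) :
    (psgdUpdate β l w).steps ≤ 12 * l.length + 7 := by
  have := steps_sumGrad_le w l
  simp only [psgdUpdate, vNormalize, vScale, vAdd, vNorm, Timed.steps_bind, steps_step, val_step]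
  omega

/-- `psgdLoop` consumes the batches from the front while `psgdIter` recurses at the end; peeling off
the first update reconciles them. -/
lemma psgdIter_succ' (β : ℝ) (B : ℕ → List (Example d)) (w₀ : Vec d) (i : ℕ) :
    psgdIter β B w₀ (i + 1) = psgdIter β (fun j => B (j + 1)) (psgdStep β (B 0) w₀) i := by
  induction i with
  | zero => rfl
  | succ i ih => rw [psgdIter, ih]; rfl

lemma val_psgdLoop (β : ℝ) (T : ℕ) (B : ℕ → List (Example d)) (w₀ : Vec d) :
    (psgdLoop β (List.ofFn fun i : Fin T => B i) w₀).val =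
      List.ofFn fun i : Fin T => psgdIter β B w₀ (i + 1) := by
  induction T generalizing B w₀ with
  | zero => simp [psgdLoop]
  | succ T ih =>
    rw [List.ofFn_succ, List.ofFn_succ]
    simp only [psgdLoop, Timed.val_bind, val_step, val_psgdUpdate, Fin.val_succ, Fin.val_zero]
    rw [ih (fun j => B (j + 1))]
    congr 1
    simp_rw [psgdIter_succ' β B w₀]

lemma steps_psgdLoop_le (β : ℝ) {N : ℕ} (bs : List (List (Example d)))
    (hN : ∀ l ∈ bs, l.length = N) (w₀ : Vec d) :
    (psgdLoop β bs w₀).steps ≤ bs.length * (12 * N + 8) := by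
  induction bs generalizing w₀ with
  | nil => simp [psgdLoop]
  | cons l bs ih =>
    have h1 := steps_psgdUpdate_le β l w₀
    have h2 := ih (fun l hl => hN l (List.mem_cons_of_mem _ hl)) (psgdUpdate β l w₀).val
    rw [hN l List.mem_cons_self] at h1
    simp only [psgdLoop, Timed.steps_bind, steps_step, List.length_cons, add_mul]
    omega

lemma val_mapList (f : α → Timed γ) (l : List α) :
    (mapList f l).val = l.map fun a => (f a).val := by
  induction l with
  | nil => rfl
  | cons a l ih => simp [mapList, ih]

lemma steps_mapList_le (f : α → Timed γ) {k : ℕ} (l : List α) (hf : ∀ a ∈ l, (f a).steps ≤ k) :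
    (mapList f l).steps ≤ l.length * (k + 1) := by
  induction l with
  | nil => simp [mapList]
  | cons a l ih =>
    have h1 := hf a List.mem_cons_self
    have h2 := ih fun a ha => hf a (List.mem_cons_of_mem _ ha)
    simp only [mapList, Timed.steps_bind, steps_step, List.length_cons, add_mul]
    omega

lemma val_relabel (c : Classifier d) (z : Example d) : (relabel c z).val = relabeled c z := rfl

lemma steps_relabel (c : Classifier d) (z : Example d) : (relabel c z).steps = 3 := rfl

lemma steps_countErr_le (c : Classifier d) (w : Vec d) (S : List (Example d)) :
    (countErr c w S).steps ≤ 6 * S.length + 1 := by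
  induction S with
  | nil => simp [countErr]
  | cons z S ih =>
    simp only [countErr, Timed.steps_bind, List.length_cons]
    split_ifs
    all_goals
      simp only [fetch, vInner, steps_leq, classify, steps_step, val_step]
      omega

lemma val_countErr (c : Classifier d) (w : Vec d) (S : List (Example d)) :
    (countErr c w S).val = (S.map ((errorSet c w).indicator fun _ => (1 : ℝ))).sum := by
  induction S with
  | nil => rfl
  | cons z S ih =>
    simp only [countErr, Timed.val_bind, List.map_cons, List.sum_cons]
    split_ifs with h
    all_goals
      rw [val_step, Bool.and_eq_true, val_leq_eq_true_iff] at h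
      simp only [fetch, vInner, classify, val_step, bne_iff_ne] at h
    · rw [Set.indicator_of_mem (show z ∈ errorSet c w from h), val_step, ih, add_comm]
    · rw [Set.indicator_of_notMem (show z ∉ errorSet c w from h), val_step, ih, zero_add]

lemma val_empErr (S : List (Example d)) (c : Classifier d) (w : Vec d) :
    (empErr S c w).val =
      (S.map ((errorSet c w).indicator fun _ => (1 : ℝ))).sum / S.length := by
  simp [empErr, val_countErr]

lemma steps_empErr_le (S : List (Example d)) (c : Classifier d) (w : Vec d) :
    (empErr S c w).steps ≤ 6 * S.length + 2 := by
  have := steps_countErr_le c w S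
  simp only [empErr, Timed.steps_bind, steps_step]
  omega

lemma steps_argminList_le (f : α → Timed ℝ) {k : ℕ} (l : List α) (hf : ∀ a ∈ l, (f a).steps ≤ k) :
    (argminList f l).steps ≤ l.length * (k + 2) := by
  induction l with
  | nil => simp [argminList]
  | cons a l ih =>
    have h1 := hf a List.mem_cons_self
    have h2 := ih fun a ha => hf a (List.mem_cons_of_mem _ ha)
    simp only [argminList, Timed.steps_bind, List.length_cons, add_mul]
    rcases (argminList f l).val with _ | q
    · simp only [steps_step]; omega
    · simp only [leq, Timed.steps_bind, steps_step]
      split_ifs <;> simp only [steps_step] <;> omega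

lemma argminList_spec (f : α → Timed ℝ) (l : List α) (hl : l ≠ []) :
    ∃ a ∈ l, (argminList f l).val = some (a, (f a).val) ∧ ∀ b ∈ l, (f a).val ≤ (f b).val := by
  induction l with
  | nil => exact absurd rfl hl
  | cons a l ih =>
    simp only [argminList, Timed.val_bind]
    rcases eq_or_ne l [] with rfl | hne
    · exact ⟨a, by simp, by simp [argminList], by simp⟩
    obtain ⟨b, hb, hval, hmin⟩ := ih hne
    rw [hval]
    simp only [leq, Timed.val_bind, val_step]
    by_cases h : (f a).val ≤ (f b).val
    · refine ⟨a, by simp, by simp [h], ?_⟩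
      simp only [List.mem_cons, forall_eq_or_imp, le_refl, true_and]
      exact fun e he => h.trans (hmin e he)
    · refine ⟨b, by simp [hb], by simp [h], ?_⟩
      simp only [List.mem_cons, forall_eq_or_imp]
      exact ⟨(not_le.1 h).le, hmin⟩

end Values

/-! ### Output and running time of the whole algorithm. -/

section Algorithm

variable {d : ℕ}

/-- The step size of projected SGD for `T` iterations. -/
def stepSize (T d : ℕ) : ℝ := √(1 / ((T : ℝ) * (d : ℝ)))

/-- The iterates inspected for the classifier `c`. -/
def iterates (bs₁ bs₂ : List (List (Example d))) (w₀ : Vec d) (c : Classifier d) : List (Vec d) :=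
  (psgd (bs₁.map (List.map (relabeled c))) w₀).val ++
    (psgd (bs₂.map (List.map (relabeled c))) ((-1 : ℝ) • w₀)).val

lemma val_mapList_relabel (c : Classifier d) (bs : List (List (Example d))) :
    (mapList (mapList (relabel c)) bs).val = bs.map (List.map (relabeled c)) := by
  rw [val_mapList]
  simp_rw [val_mapList, val_relabel]

lemma val_selectorFor (bs₁ bs₂ : List (List (Example d))) (S : List (Example d)) (w₀ : Vec d)
    (c : Classifier d) : (selectorFor bs₁ bs₂ S w₀ c).val =
      (argminList (empErr S c) (iterates bs₁ bs₂ w₀ c)).val := by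
  simp [selectorFor, iterates, val_mapList_relabel, vScale]

/-- These two properties are all that the analysis needs of the selection, so the way ties are
broken is irrelevant. -/
lemma mem_candidates {bs₁ bs₂ : List (List (Example d))} {S : List (Example d)} {w₀ : Vec d}
    {cs : List (Classifier d)} (hne : ∀ c ∈ cs, iterates bs₁ bs₂ w₀ c ≠ []) :
    (∀ p ∈ (candidates bs₁ bs₂ S w₀ cs).val, p.1 ∈ cs ∧ p.2 ∈ iterates bs₁ bs₂ w₀ p.1) ∧
      ∀ c ∈ cs, ∀ w ∈ iterates bs₁ bs₂ w₀ c, ∃ w', (c, w') ∈ (candidates bs₁ bs₂ S w₀ cs).val ∧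
        (empErr S c w').val ≤ (empErr S c w).val := by
  induction cs with
  | nil => simp [candidates]
  | cons c cs ih =>
    obtain ⟨h1, h2⟩ := ih fun c hc => hne c (List.mem_cons_of_mem _ hc)
    obtain ⟨w, hw, hval, hmin⟩ := argminList_spec (empErr S c) _ (hne c List.mem_cons_self)
    have hv : (candidates bs₁ bs₂ S w₀ (c :: cs)).val =
        (c, w) :: (candidates bs₁ bs₂ S w₀ cs).val := by
      simp [candidates, val_selectorFor, hval]
    rw [hv]
    constructor
    · intro p hp
      rcases List.mem_cons.1 hp with rfl | hp
      · exact ⟨List.mem_cons_self, hw⟩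
      · exact ⟨List.mem_cons_of_mem _ (h1 p hp).1, (h1 p hp).2⟩
    · intro c' hc' w' hw'
      rcases List.mem_cons.1 hc' with rfl | hc'
      · exact ⟨w, List.mem_cons_self, hmin w' hw'⟩
      · obtain ⟨w'', h3, h4⟩ := h2 c' hc' w' hw'
        exact ⟨w'', List.mem_cons_of_mem _ h3, h4⟩

lemma length_psgdLoop (β : ℝ) (bs : List (List (Example d))) (w₀ : Vec d) :
    (psgdLoop β bs w₀).val.length = bs.length := by
  induction bs generalizing w₀ with
  | nil => rfl
  | cons l bs ih => simp [psgdLoop, ih]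

lemma length_psgd (bs : List (List (Example d))) (w₀ : Vec d) :
    (psgd bs w₀).val.length = bs.length := by
  simp [psgd, length_psgdLoop]

lemma steps_psgd_le {N : ℕ} (bs : List (List (Example d))) (hN : ∀ l ∈ bs, l.length = N)
    (w₀ : Vec d) : (psgd bs w₀).steps ≤ bs.length * (12 * N + 8) + 1 := by
  have := steps_psgdLoop_le (stepSize bs.length d) bs hN w₀
  simp only [psgd, Timed.steps_bind, steps_step, val_step]
  rw [stepSize] at this
  omega

lemma steps_selectorFor_le {T N : ℕ} (bs₁ bs₂ : List (List (Example d))) (S : List (Example d))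
    (h1 : bs₁.length = T) (h2 : bs₂.length = T) (hN1 : ∀ l ∈ bs₁, l.length = N)
    (hN2 : ∀ l ∈ bs₂, l.length = N) (w₀ : Vec d) (c : Classifier d) :
    (selectorFor bs₁ bs₂ S w₀ c).steps ≤
      T * (32 * N + 12 * S.length + 27) + 3 := by
  have hr : ∀ bs : List (List (Example d)), bs.length = T → (∀ l ∈ bs, l.length = N) →
      (mapList (mapList (relabel c)) bs).steps ≤ T * (4 * N + 1) := by
    intro bs hb hN
    refine (steps_mapList_le _ (k := 4 * N) _ fun l hl => ?_).trans (by rw [hb])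
    refine (steps_mapList_le _ (k := 3) _ fun a _ => (steps_relabel c a).le).trans ?_
    rw [hN l hl, mul_comm]
  have hp : ∀ (bs : List (List (Example d))) (w : Vec d), bs.length = T →
      (∀ l ∈ bs, l.length = N) →
      (psgd (bs.map (List.map (relabeled c))) w).steps ≤ T * (12 * N + 8) + 1 := by
    intro bs w hb hN
    refine (steps_psgd_le (N := N) _ ?_ w).trans (by simp [hb])
    simpa using hN
  have ha := steps_argminList_le (empErr S c) (k := 6 * S.length + 2) (iterates bs₁ bs₂ w₀ c)
    fun a _ => steps_empErr_le S c a
  have hl : (iterates bs₁ bs₂ w₀ c).length = 2 * T := by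
    simp [iterates, length_psgd, h1, h2, two_mul]
  have e1 := hr bs₁ h1 hN1
  have e2 := hr bs₂ h2 hN2
  have e3 := hp bs₁ w₀ h1 hN1
  have e4 := hp bs₂ ((-1 : ℝ) • w₀) h2 hN2
  have e5 : (psgd (bs₁.map (List.map (relabeled c))) w₀).val.length = T := by
    simp [length_psgd, h1]
  rw [hl] at ha
  simp only [selectorFor, Timed.steps_bind, val_mapList_relabel, vScale, steps_step, val_step]
  change _ + (_ + (_ + (_ + (_ + (_ +
    (argminList (empErr S c) (iterates bs₁ bs₂ w₀ c)).steps))))) ≤ _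
  rw [e5]
  -- Coefficient of `N`: `2·4` for relabelling and `2·12` for the updates. The `2T` error
  -- evaluations give `12|S| + 8`; the rest of 27 is `2·1 + 2·8` and 1 for joining the lists.
  nlinarith

lemma steps_candidates_le {k : ℕ} (bs₁ bs₂ : List (List (Example d))) (S : List (Example d))
    (w₀ : Vec d) (cs : List (Classifier d))
    (hk : ∀ c, (selectorFor bs₁ bs₂ S w₀ c).steps ≤ k) :
    (candidates bs₁ bs₂ S w₀ cs).steps ≤ cs.length * (k + 1) ∧
      (candidates bs₁ bs₂ S w₀ cs).val.length ≤ cs.length := by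
  induction cs with
  | nil => simp [candidates]
  | cons c cs ih =>
    have h1 := hk c
    simp only [candidates, Timed.steps_bind, Timed.val_bind, List.length_cons, add_mul]
    rcases (selectorFor bs₁ bs₂ S w₀ c).val with _ | p
    · simp only [steps_step, val_step]; omega
    · simp only [steps_step, val_step, List.length_cons]; omega

lemma card_drawIdx (m : ℕ) (ε δ : ℝ) : Fintype.card (DrawIdx d m ε δ) =
    2 * (numIter d m ε δ * batchSize d m ε δ) + validSize d m ε δ := by
  simp [DrawIdx]

lemma length_batchesOf {m : ℕ} {ε δ : ℝ} (ω : DrawIdx d m ε δ → Example d) (b : Bool) :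
    (batchesOf ω b).length = numIter d m ε δ ∧
      ∀ l ∈ batchesOf ω b, l.length = batchSize d m ε δ := by
  refine ⟨by simp [batchesOf], fun l hl => ?_⟩
  obtain ⟨i, rfl⟩ := (List.mem_ofFn' _ _).1 hl
  simp

lemma length_validOf {m : ℕ} {ε δ : ℝ} (ω : DrawIdx d m ε δ → Example d) :
    (validOf ω).length = validSize d m ε δ := by
  simp [validOf]

lemma steps_ccfc_le (cs : List (Classifier d)) (w₀ : Vec d) (ε δ : ℝ)
    (ω : DrawIdx d cs.length ε δ → Example d) {T N M : ℕ} (hT : T = numIter d cs.length ε δ)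
    (hN : N = batchSize d cs.length ε δ) (hM : M = validSize d cs.length ε δ) :
    (ccfc cs w₀ ε δ ω).steps ≤
      2 * (T * N) + M + cs.length * (T * (32 * N + 12 * M + 27) + 6 * M + 8) + 1 := by
  obtain ⟨h1, h1'⟩ := length_batchesOf ω true
  obtain ⟨h2, h2'⟩ := length_batchesOf ω false
  have hS := length_validOf ω
  rw [← hT] at h1 h2
  rw [← hN] at h1' h2'
  rw [← hM] at hS
  have h3 := fun c => steps_selectorFor_le (batchesOf ω true) (batchesOf ω false) (validOf ω)
    h1 h2 h1' h2' w₀ c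
  rw [hS] at h3
  obtain ⟨h4, h5⟩ := steps_candidates_le _ _ _ w₀ cs h3
  have h6 := steps_argminList_le (fun p : Classifier d × Vec d => empErr (validOf ω) p.1 p.2)
    (k := 6 * M + 2) (candidates (batchesOf ω true) (batchesOf ω false) (validOf ω) w₀ cs).val
    fun p _ => (steps_empErr_le _ _ _).trans (by rw [hS])
  have h7 := Nat.mul_le_mul_right (6 * M + 2 + 2) h5
  have h8 := card_drawIdx (d := d) cs.length ε δ
  simp only [ccfc, Timed.steps_bind, steps_step]
  rw [h8, ← hT, ← hN, ← hM]
  nlinarith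

end Algorithm

/-! ### Empirical gradients and the potential argument. -/

section Gradient

variable {d : ℕ}

lemma relabeled_snd_eq_true_iff (c : Classifier d) (z : Example d) :
    (relabeled c z).2 = true ↔ c z.1 ≠ z.2 := by
  simp [relabeled]

lemma gradVec_of_norm_eq_one {w : Vec d} (hw : ‖w‖ = 1) (z : Example d) :
    gradVec w z = if z.2 = true ∧ 0 ≤ inner ℝ z.1 w then z.1 - inner ℝ z.1 w • w else 0 := by
  simp [gradVec, hw, sub_eq_add_neg]

lemma inner_gradVec_self {w : Vec d} (hw : ‖w‖ = 1) (z : Example d) :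
    inner ℝ (gradVec w z) w = 0 := by
  rw [gradVec_of_norm_eq_one hw]
  split_ifs
  · rw [inner_sub_left, inner_smul_left, real_inner_self_eq_norm_sq, hw]; simp
  · exact inner_zero_left _

lemma norm_gradVec_le {w : Vec d} (hw : ‖w‖ = 1) (z : Example d) : ‖gradVec w z‖ ≤ ‖z.1‖ := by
  rw [gradVec_of_norm_eq_one hw]
  split_ifs
  · apply le_of_sq_le_sq _ (norm_nonneg _)
    rw [norm_sub_sq_real, norm_smul, hw, inner_smul_right, Real.norm_eq_abs, mul_one, sq_abs]
    nlinarith [sq_nonneg (inner ℝ z.1 w)]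
  · simp

/-- Relabelling makes the gradient active exactly on the error set of `w`, and the self-adjoint
projection off `w` can be moved from `x` to `v`. -/
lemma inner_gradVec_relabeled {w : Vec d} (hw : ‖w‖ = 1) (c : Classifier d) (v : Vec d)
    (z : Example d) : inner ℝ (gradVec w (relabeled c z)) v =
      (errorSet c w).indicator (fun z => inner ℝ z.1 (perp w v)) z := by
  rw [gradVec_of_norm_eq_one hw]
  have hr := relabeled_snd_eq_true_iff c z
  by_cases h : z ∈ errorSet c w
  · rw [Set.indicator_of_mem h, if_pos ⟨hr.2 h.2, h.1⟩, inner_perp, inner_sub_left, inner_smul_left]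
    simp [relabeled, mul_comm]
  · rw [Set.indicator_of_notMem h, if_neg fun h' => h ⟨h'.2, hr.1 h'.1⟩, inner_zero_left]

/-- The empirical mean of the projected gradient over a relabelled batch. -/
def gradMean (c : Classifier d) {N : ℕ} (w : Vec d) (z : Fin N → Example d) : Vec d :=
  (N : ℝ)⁻¹ • ∑ j, gradVec w (relabeled c (z j))

/-- One update of projected SGD on a relabelled batch. -/
def sgdStep (c : Classifier d) (β : ℝ) {N : ℕ} (w : Vec d) (z : Fin N → Example d) : Vec d :=
  ‖w - β • gradMean c w z‖⁻¹ • (w - β • gradMean c w z)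

lemma psgdStep_ofFn (c : Classifier d) (β : ℝ) {N : ℕ} (w : Vec d) (z : Fin N → Example d) :
    psgdStep β (List.ofFn fun j => relabeled c (z j)) w = sgdStep c β w z := by
  have : w + (-(β / ((List.ofFn fun j => relabeled c (z j)).length : ℝ))) •
      ((List.ofFn fun j => relabeled c (z j)).map (gradVec w)).sum = w - β • gradMean c w z := by
    rw [List.length_ofFn, List.map_ofFn, List.sum_ofFn, gradMean, smul_smul, neg_smul,
      ← sub_eq_add_neg, div_eq_mul_inv]
    rfl
  rw [psgdStep, this, sgdStep]

lemma inner_gradMean_self (c : Classifier d) {N : ℕ} {w : Vec d} (hw : ‖w‖ = 1)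
    (z : Fin N → Example d) : inner ℝ (gradMean c w z) w = 0 := by
  rw [gradMean, inner_smul_left, sum_inner,
    Finset.sum_eq_zero fun j _ => inner_gradVec_self hw _, mul_zero]

lemma inner_gradMean (c : Classifier d) {N : ℕ} {w : Vec d} (hw : ‖w‖ = 1) (v : Vec d)
    (z : Fin N → Example d) : inner ℝ (gradMean c w z) v =
      (N : ℝ)⁻¹ * ∑ j, (errorSet c w).indicator (fun z => inner ℝ z.1 (perp w v)) (z j) := by
  rw [gradMean, inner_smul_left, sum_inner]
  simp_rw [inner_gradVec_relabeled hw]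
  simp

/-- Projection shortens vectors, and the square of a mean is at most the mean of the squares. -/
lemma norm_gradMean_sq_le (c : Classifier d) {N : ℕ} (hN : 0 < N) {w : Vec d} (hw : ‖w‖ = 1)
    {z : Fin N → Example d} {R : ℝ} (hz : ∑ j, ‖(z j).1‖ ^ 2 ≤ N * R) :
    ‖gradMean c w z‖ ^ 2 ≤ R := by
  have hN' : (0 : ℝ) < N := by exact_mod_cast hN
  have h1 : ‖∑ j, gradVec w (relabeled c (z j))‖ ≤ ∑ j, ‖(z j).1‖ :=
    norm_sum_le_of_le _ fun j _ => norm_gradVec_le hw (relabeled c (z j))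
  have h2 : (∑ j, ‖(z j).1‖) ^ 2 ≤ N * ∑ j, ‖(z j).1‖ ^ 2 := by
    simpa using sq_sum_le_card_mul_sum_sq (s := Finset.univ) (f := fun j => ‖(z j).1‖)
  rw [gradMean, norm_smul, norm_inv, Real.norm_natCast, mul_pow, inv_pow,
    inv_mul_le_iff₀ (by positivity)]
  calc _ ≤ (∑ j, ‖(z j).1‖) ^ 2 := by gcongr
    _ ≤ N * (N * R) := h2.trans (by gcongr)
    _ = _ := by ring

/-- Normalizing a vector of norm at least one moves it closer to every point of the unit ball. -/
lemma norm_normalize_sub_sq_le {u a : Vec d} (hu : 1 ≤ ‖u‖) (ha : ‖a‖ ≤ 1) :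
    ‖‖u‖⁻¹ • u - a‖ ^ 2 ≤ ‖u - a‖ ^ 2 := by
  have hu0 : 0 < ‖u‖ := by linarith
  rw [norm_sub_sq_real, norm_sub_sq_real, norm_smul, norm_inv, norm_norm,
    inv_mul_cancel₀ hu0.ne', inner_smul_left]
  have h1 : inner ℝ u a ≤ ‖u‖ := (real_inner_le_norm u a).trans (mul_le_of_le_one_right hu0.le ha)
  have h2 : (inner ℝ u a : ℝ) = ‖u‖ * (‖u‖⁻¹ * inner ℝ u a) := by field_simp
  set t := ‖u‖⁻¹ * inner ℝ u a
  have ht : t ≤ 1 := by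
    rw [h2] at h1
    exact le_of_mul_le_mul_left (h1.trans_eq (mul_one _).symm) hu0
  change 1 ^ 2 - 2 * t + _ ≤ _
  -- The difference of the two sides is `(‖u‖ - 1)(‖u‖ + 1 - 2t)`.
  nlinarith [mul_nonneg (sub_nonneg.2 hu) (by linarith : 0 ≤ ‖u‖ + 1 - 2 * t)]

/-- Pythagoras. It is the reason for projecting the gradient: the update never enters the open unit
ball, so `norm_normalize_sub_sq_le` applies. -/
lemma one_le_norm_sub_smul {w g : Vec d} (hw : ‖w‖ = 1) (hg : inner ℝ g w = 0) (β : ℝ) :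
    1 ≤ ‖w - β • g‖ := by
  apply one_le_sq_iff₀ (norm_nonneg _) |>.1
  rw [norm_sub_sq_real, hw, inner_smul_right, real_inner_comm, hg]
  nlinarith [sq_nonneg ‖β • g‖]

/-- Potential argument for projected SGD: the gradients cannot have a large component away from
`v` at all the iterates. -/
lemma exists_not_bad_of_drift {w g : ℕ → Vec d} {v : Vec d} {T : ℕ} {β ε : ℝ} {Bad : Vec d → Prop}
    (hd : 0 < d) (hT : 4 * d ≤ T * ε ^ 4) (hε : 0 < ε) (hβ : β = stepSize T d)
    (hv : ‖v‖ = 1) (hw0 : ‖w 0‖ = 1) (hstart : 0 ≤ inner ℝ (w 0) v)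
    (hstep : ∀ i < T, w (i + 1) = ‖w i - β • g i‖⁻¹ • (w i - β • g i))
    (horth : ∀ i < T, ‖w i‖ = 1 → inner ℝ (g i) (w i) = 0)
    (hnorm : ∀ i < T, ‖w i‖ = 1 → ‖g i‖ ^ 2 ≤ 4 * d)
    (hdrift : ∀ i < T, ‖w i‖ = 1 → 0 ≤ inner ℝ (w i) v → Bad (w i) →
      inner ℝ (g i) v ≤ -(2 * ε ^ 2)) :
    ∃ i < T, ¬ Bad (w i) := by
  by_contra! hbad
  have hd' : (0 : ℝ) < d := by exact_mod_cast hd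
  have hT' : (0 : ℝ) < T := by
    by_contra h
    have : (T : ℝ) * ε ^ 4 ≤ 0 := mul_nonpos_of_nonpos_of_nonneg (not_lt.1 h) (by positivity)
    linarith
  have hβ0 : 0 ≤ β := hβ ▸ Real.sqrt_nonneg _
  have hβ2 : β ^ 2 * (T * d) = 1 := by
    rw [hβ, stepSize, Real.sq_sqrt (by positivity)]; field_simp
  -- The sign of `⟨w i, v⟩` must be carried along because `hdrift` requires it; it persists since a
  -- bad step adds `-β⟨g i, v⟩ ≥ 0` before normalization.
  have key : ∀ i ≤ T, ‖w i‖ = 1 ∧ 0 ≤ inner ℝ (w i) v ∧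
      ‖w i - v‖ ^ 2 ≤ 2 + i * (4 * d * β ^ 2 - 4 * β * ε ^ 2) := by
    intro i
    induction i with
    | zero =>
      refine fun _ => ⟨hw0, hstart, ?_⟩
      rw [norm_sub_sq_real, hw0, hv]
      simp only [Nat.cast_zero, zero_mul]
      linarith
    | succ i ih =>
      intro hi
      have hi' : i < T := hi
      obtain ⟨h1, h2, h3⟩ := ih hi'.le
      have ho := horth i hi' h1
      have hu := one_le_norm_sub_smul h1 ho β
      have hu0 : 0 < ‖w i - β • g i‖ := by linarith
      have hdr := hdrift i hi' h1 h2 (hbad i hi')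
      have hn := hnorm i hi' h1
      rw [hstep i hi']
      refine ⟨?_, ?_, (norm_normalize_sub_sq_le hu hv.le).trans ?_⟩
      · rw [norm_smul, norm_inv, norm_norm, inv_mul_cancel₀ hu0.ne']
      · rw [inner_smul_left, inner_sub_left, inner_smul_left]
        simp only [conj_trivial]
        have : β * inner ℝ (g i) v ≤ 0 :=
          mul_nonpos_of_nonneg_of_nonpos hβ0 (hdr.trans (by simp; positivity))
        exact mul_nonneg (inv_nonneg.2 hu0.le) (by linarith)
      · have e : w i - β • g i - v = (w i - v) - β • g i := by abel
        rw [e, norm_sub_sq_real, inner_smul_right, inner_sub_left, real_inner_comm, ho, norm_smul,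
          mul_pow, Real.norm_eq_abs, sq_abs, real_inner_comm]
        have a1 : β * inner ℝ (g i) v ≤ β * -(2 * ε ^ 2) := by gcongr
        have a2 : β ^ 2 * ‖g i‖ ^ 2 ≤ β ^ 2 * (4 * d) := by gcongr
        push_cast
        linarith
  obtain ⟨-, -, h⟩ := key T le_rfl
  have h0 := sq_nonneg ‖w T - v‖
  -- As `β²Td = 1`, the potential after `T` steps is at most `2 + 4 - 4βε²T ≤ -2`, a contradiction.
  have h4 : 2 ≤ β * ε ^ 2 * T := by
    apply le_of_sq_le_sq _ (by positivity)
    calc (2 : ℝ) ^ 2 = β ^ 2 * T * (4 * d) := by linarith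
      _ ≤ β ^ 2 * T * (T * ε ^ 4) := by gcongr
      _ = _ := by ring
  nlinarith

end Gradient

/-! ### The iterates as functions of the sample. -/

section Trajectory

variable {d T N M : ℕ}

/-- The `i`-th batch of the run `b`. -/
def batchAt (ω : (Bool × Fin T × Fin N) ⊕ Fin M → Example d) (b : Bool) (i : Fin T) :
    Fin N → Example d := fun j => ω (Sum.inl (b, i, j))

/-- The iterates of the run `b` of projected SGD for the classifier `c`. -/
def traj (c : Classifier d) (β : ℝ) (w : Vec d) (b : Bool)
    (ω : (Bool × Fin T × Fin N) ⊕ Fin M → Example d) : ℕ → Vec d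
  | 0 => w
  | i + 1 => if h : i < T then sgdStep c β (traj c β w b ω i) (batchAt ω b ⟨i, h⟩)
      else traj c β w b ω i

lemma traj_succ (c : Classifier d) (β : ℝ) (w : Vec d) (b : Bool)
    (ω : (Bool × Fin T × Fin N) ⊕ Fin M → Example d) (i : Fin T) :
    traj c β w b ω (i + 1) = sgdStep c β (traj c β w b ω i) (batchAt ω b i) := by
  rw [traj, dif_pos i.2]

lemma norm_sgdStep (c : Classifier d) (β : ℝ) {w : Vec d} (hw : ‖w‖ = 1)
    (z : Fin N → Example d) : ‖sgdStep c β w z‖ = 1 := by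
  have := one_le_norm_sub_smul hw (inner_gradMean_self c hw z) β
  rw [sgdStep, norm_smul, norm_inv, norm_norm, inv_mul_cancel₀ (by linarith)]

lemma norm_traj (c : Classifier d) (β : ℝ) {w : Vec d} (hw : ‖w‖ = 1) (b : Bool)
    (ω : (Bool × Fin T × Fin N) ⊕ Fin M → Example d) (i : ℕ) : ‖traj c β w b ω i‖ = 1 := by
  induction i with
  | zero => exact hw
  | succ i ih =>
    rw [traj]
    split_ifs
    · exact norm_sgdStep c β ih _
    · exact ih

/-- The `i`-th iterate reads only the batches before `i`. This makes batch `i` fresh for it, and the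
validation set fresh for all iterates. -/
lemma traj_congr (c : Classifier d) (β : ℝ) (w : Vec d) (b : Bool)
    {ω ω' : (Bool × Fin T × Fin N) ⊕ Fin M → Example d} (i : ℕ)
    (h : ∀ i' : Fin T, (i' : ℕ) < i → batchAt ω b i' = batchAt ω' b i') :
    traj c β w b ω i = traj c β w b ω' i := by
  induction i with
  | zero => rfl
  | succ i ih =>
    rw [traj, traj, ih fun i' hi' => h i' (by omega)]
    split_ifs with hi
    · rw [h ⟨i, hi⟩ (by simp)]
    · rfl

/-- The initial vectors of the two runs. -/
def startVec (w₀ : Vec d) (b : Bool) : Vec d := if b then w₀ else (-1 : ℝ) • w₀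

lemma norm_startVec {w₀ : Vec d} (hw : ‖w₀‖ = 1) (b : Bool) : ‖startVec w₀ b‖ = 1 := by
  cases b <;> simp [startVec, hw]

/-- The purpose of the second run: `v` is unknown, and the drift is available only on the side `⟨w,
v⟩ ≥ 0`. -/
lemma exists_startVec_inner_nonneg (w₀ v : Vec d) : ∃ b, 0 ≤ inner ℝ (startVec w₀ b) v := by
  rcases le_total 0 (inner ℝ w₀ v) with h | h
  · exact ⟨true, by simpa [startVec] using h⟩
  · exact ⟨false, by simpa [startVec] using h⟩

lemma val_psgd_batches (c : Classifier d) (w : Vec d) (b : Bool)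
    (ω : (Bool × Fin T × Fin N) ⊕ Fin M → Example d) :
    (psgd ((List.ofFn fun i => List.ofFn (batchAt ω b i)).map (List.map (relabeled c))) w).val =
      List.ofFn fun i : Fin T => traj c (stepSize T d) w b ω (i + 1) := by
  set B : ℕ → List (Example d) := fun i =>
    if h : i < T then List.ofFn fun j => relabeled c (batchAt ω b ⟨i, h⟩ j) else [] with hB
  have h1 : (List.ofFn fun i => List.ofFn (batchAt ω b i)).map (List.map (relabeled c)) =
      List.ofFn fun i : Fin T => B i := by
    rw [List.map_ofFn]
    congr 1; ext1 i
    simp only [hB, Function.comp_apply, List.map_ofFn, i.2, dif_pos]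
    rfl
  have h2 : ∀ i ≤ T, psgdIter (stepSize T d) B w i = traj c (stepSize T d) w b ω i := by
    intro i
    induction i with
    | zero => exact fun _ => rfl
    | succ i ih =>
      intro hi
      have hi' : i < T := hi
      rw [psgdIter, traj, dif_pos hi', ih hi'.le]
      simp only [hB, dif_pos hi']
      exact psgdStep_ofFn c _ _ _
  rw [h1]
  simp only [psgd, Timed.val_bind, val_step, List.length_ofFn]
  refine (val_psgdLoop _ T B w).trans ?_
  congr 1; ext1 i
  exact h2 _ i.2

lemma mem_iterates_iff {m : ℕ} {ε δ : ℝ} (ω : DrawIdx d m ε δ → Example d) (w₀ : Vec d)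
    (c : Classifier d) (w : Vec d) :
    w ∈ iterates (batchesOf ω true) (batchesOf ω false) w₀ c ↔
      ∃ (b : Bool) (i : Fin (numIter d m ε δ)),
        w = traj c (stepSize (numIter d m ε δ) d) (startVec w₀ b) b ω (i + 1) := by
  have h : ∀ b w, (psgd ((batchesOf ω b).map (List.map (relabeled c))) w).val = _ :=
    fun b w => val_psgd_batches c w b ω
  rw [iterates, List.mem_append, h, h, List.mem_ofFn', List.mem_ofFn']
  simp only [Set.mem_range, Bool.exists_bool, startVec, eq_comm (a := w)]
  exact or_comm

lemma val_empErr_validOf {m : ℕ} {ε δ : ℝ} (ω : DrawIdx d m ε δ → Example d) (c : Classifier d)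
    (w : Vec d) : (empErr (validOf ω) c w).val =
      (∑ j, (errorSet c w).indicator (fun _ => (1 : ℝ)) (ω (Sum.inr j))) / validSize d m ε δ := by
  rw [val_empErr, length_validOf, validOf, List.map_ofFn, List.sum_ofFn]
  rfl

end Trajectory

/-! ### Joint measurability of updates, iterates and error sets. -/

section Measurability

variable {d T N M : ℕ}

lemma measurable_gradVec : Measurable fun p : Vec d × Example d => gradVec p.1 p.2 := by
  refine Measurable.ite ?_ (by fun_prop) measurable_const
  exact (measurableSet_eq_fun (f := fun p : Vec d × Example d => p.2.2) (by fun_prop)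
    measurable_const).inter (measurableSet_le measurable_const
    (g := fun p : Vec d × Example d => (inner ℝ p.2.1 p.1 : ℝ)) (by fun_prop))

lemma measurable_relabeled {c : Classifier d} (hc : Measurable c) : Measurable (relabeled c) := by
  have h : Measurable fun p : Bool × Bool => p.1 ^^ p.2 := .of_discrete
  exact measurable_fst.prodMk (h.comp ((hc.comp measurable_fst).prodMk measurable_snd))

lemma measurable_sgdStep {c : Classifier d} (hc : Measurable c) (β : ℝ) :
    Measurable fun p : Vec d × (Fin N → Example d) => sgdStep c β p.1 p.2 := by
  have h1 : ∀ j, Measurable fun p : Vec d × (Fin N → Example d) =>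
      gradVec p.1 (relabeled c (p.2 j)) := fun j =>
    measurable_gradVec.comp (measurable_fst.prodMk
      ((measurable_relabeled hc).comp ((measurable_pi_apply j).comp measurable_snd)))
  have h2 : Measurable fun p : Vec d × (Fin N → Example d) => gradMean c p.1 p.2 := by
    unfold gradMean
    exact (Finset.measurable_sum _ fun j _ => h1 j).const_smul (N : ℝ)⁻¹
  have h3 : Measurable fun p : Vec d × (Fin N → Example d) => p.1 - β • gradMean c p.1 p.2 :=
    measurable_fst.sub (h2.const_smul β)
  exact h3.norm.inv.smul h3

lemma measurable_traj {c : Classifier d} (hc : Measurable c) (β : ℝ) (w : Vec d) (b : Bool)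
    (i : ℕ) : Measurable fun ω : (Bool × Fin T × Fin N) ⊕ Fin M → Example d =>
      traj c β w b ω i := by
  induction i with
  | zero => exact measurable_const
  | succ i ih =>
    by_cases h : i < T
    · have e : (fun ω : (Bool × Fin T × Fin N) ⊕ Fin M → Example d => traj c β w b ω (i + 1)) =
          fun ω => sgdStep c β (traj c β w b ω i) (batchAt ω b ⟨i, h⟩) :=
        funext fun ω => traj_succ c β w b ω ⟨i, h⟩
      have hb : Measurable fun ω : (Bool × Fin T × Fin N) ⊕ Fin M → Example d =>
          batchAt ω b ⟨i, h⟩ := measurable_pi_lambda _ fun j => measurable_pi_apply _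
      have hs := (measurable_sgdStep (N := N) hc β).comp (ih.prodMk hb)
      rw [e]
      exact hs
    · have e : (fun ω : (Bool × Fin T × Fin N) ⊕ Fin M → Example d => traj c β w b ω (i + 1)) =
          fun ω => traj c β w b ω i := funext fun ω => by rw [traj, dif_neg h]
      rwa [e]

lemma measurable_errorSet_indicator {c : Classifier d} (hc : Measurable c)
    {f : Vec d × Example d → ℝ} (hf : Measurable f) :
    Measurable fun p : Vec d × Example d => (errorSet c p.1).indicator (fun z => f (p.1, z)) p.2 := by
  exact hf.indicator (measurableSet_errorSet_uncurry hc)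

end Measurability

/-! ### Probabilities of the deviation events. -/

section Events

variable {X ι κ W : Type*} [MeasurableSpace X] [MeasurableSpace W] [Fintype ι] [Fintype κ]

/-- Fresh sums exceed a threshold that depends on the past with small probability, if this holds
for each fixed past. -/
lemma measureReal_pi_fresh_sum_ge_le (μ : Measure X) [IsProbabilityMeasure μ] (e : κ ↪ ι)
    {g : (ι → X) → W} (hg : Measurable g)
    (hloc : ∀ ω ω', (∀ i, i ∉ Set.range e → ω i = ω' i) → g ω = g ω')
    {P : Set W} (hP : MeasurableSet P) {Y : W → X → ℝ}
    (hY : Measurable fun p : W × X => Y p.1 p.2) {θ : W → ℝ} (hθ : Measurable θ) {q : ℝ}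
    (hq0 : 0 ≤ q)
    (hq : ∀ w ∈ P, (Measure.pi fun _ : κ => μ).real {z | θ w ≤ ∑ j, Y w (z j)} ≤ q) :
    (Measure.pi fun _ : ι => μ).real
      {ω | g ω ∈ P ∧ θ (g ω) ≤ ∑ j, Y (g ω) (ω (e j))} ≤ q := by
  have hsum : Measurable fun p : W × (κ → X) => ∑ j, Y p.1 (p.2 j) :=
    Finset.measurable_sum _ fun j _ =>
      hY.comp (measurable_fst.prodMk ((measurable_pi_apply j).comp measurable_snd))
  have hA : MeasurableSet {p : W × (κ → X) | p.1 ∈ P ∧ θ p.1 ≤ ∑ j, Y p.1 (p.2 j)} :=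
    (measurable_fst hP).inter (measurableSet_le (hθ.comp measurable_fst) hsum)
  refine measureReal_pi_fresh_le μ e hg hloc hA fun w => ?_
  by_cases hw : w ∈ P
  · simpa [hw] using hq w hw
  · simpa [hw] using hq0

end Events

section Probability

variable {d T N M : ℕ} {D : Measure (Example d)} [IsProbabilityMeasure D]

/-- The coordinates of one batch. -/
def batchEmb (T N M : ℕ) (b : Bool) (i : Fin T) : Fin N ↪ (Bool × Fin T × Fin N) ⊕ Fin M :=
  ⟨fun j => Sum.inl (b, i, j), fun j j' h => by simpa using h⟩

/-- A large deviation of the gradient in direction `v` at one iteration. -/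
def gradDeviation (D : Measure (Example d)) (c : Classifier d) (β : ℝ) (w v : Vec d) (ε : ℝ)
    (b : Bool) (i : Fin T) : Set ((Bool × Fin T × Fin N) ⊕ Fin M → Example d) :=
  {ω | 0 < ‖perp (traj c β w b ω i) v‖ ∧
    N * (∫ z, (errorSet c (traj c β w b ω i)).indicator
        (fun z => inner ℝ z.1 (perp (traj c β w b ω i) v)) z ∂D
      + ‖perp (traj c β w b ω i) v‖ * ε) ≤
    ∑ j, (errorSet c (traj c β w b ω i)).indicator
        (fun z => inner ℝ z.1 (perp (traj c β w b ω i) v)) (batchAt ω b i j)}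

lemma measurable_perp (v : Vec d) : Measurable fun w : Vec d => perp w v := by
  unfold perp; fun_prop

/-- Dividing by `‖perp w v‖` leaves a unit direction `u`, where the summands are dominated by `|⟨x,
u⟩|`; the bound is therefore free of the dimension. -/
lemma measureReal_pi_gradient_deviation_le (hD : D.fst = stdGaussian (Vec d)) {c : Classifier d}
    (hc : Measurable c) {w v : Vec d} (hs : 0 < ‖perp w v‖) {ε : ℝ} (hε : 0 ≤ ε) (hε1 : ε ≤ 1) :
    (Measure.pi fun _ : Fin N => D).real
      {z | N * (∫ z, (errorSet c w).indicator (fun z => inner ℝ z.1 (perp w v)) z ∂D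
        + ‖perp w v‖ * ε) ≤
        ∑ j, (errorSet c w).indicator (fun z => inner ℝ z.1 (perp w v)) (z j)} ≤
      Real.exp (-(N * ε ^ 2 / 120)) := by
  set s := ‖perp w v‖ with hsdef
  set u := s⁻¹ • perp w v with hudef
  have hu : ‖u‖ = 1 := by
    rw [hudef, norm_smul, norm_inv, hsdef, norm_norm, inv_mul_cancel₀ hs.ne']
  have hpu : perp w v = s • u := by rw [hudef, smul_smul, mul_inv_cancel₀ hs.ne', one_smul]
  have h4 : ∀ z, (errorSet c w).indicator (fun z => inner ℝ z.1 (perp w v)) z =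
      s * (errorSet c w).indicator (fun z => inner ℝ z.1 u) z := by
    intro z
    rw [hpu]
    by_cases hz : z ∈ errorSet c w
    · rw [Set.indicator_of_mem hz, Set.indicator_of_mem hz, inner_smul_right]
    · rw [Set.indicator_of_notMem hz, Set.indicator_of_notMem hz, mul_zero]
  obtain ⟨i1, i2⟩ := integral_exp_two_mul_abs_inner_le hD hu
  have hYm : Measurable ((errorSet c w).indicator fun z => (inner ℝ z.1 u : ℝ)) :=
    Measurable.indicator (by fun_prop) (measurableSet_errorSet hc w)
  have h := measureReal_pi_sum_ge_mean_add_le (ι := Fin N) hYm (fun z => by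
    by_cases hz : z ∈ errorSet c w
    · rw [Set.indicator_of_mem hz]
    · rw [Set.indicator_of_notMem hz, abs_zero]; exact abs_nonneg _) i1 i2 hε (by linarith)
  rw [Fintype.card_fin] at h
  refine le_trans (le_of_eq ?_) h
  congr 1
  ext z
  simp_rw [Set.mem_ofPred_eq, h4, integral_const_mul, ← Finset.mul_sum]
  rw [← mul_add, mul_left_comm, mul_le_mul_iff_right₀ hs]

lemma measureReal_gradDeviation_le (hD : D.fst = stdGaussian (Vec d)) {c : Classifier d}
    (hc : Measurable c) (β : ℝ) (w v : Vec d) {ε : ℝ} (hε : 0 ≤ ε) (hε1 : ε ≤ 1) (b : Bool)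
    (i : Fin T) : (Measure.pi fun _ => D).real
      (gradDeviation D c β w v ε b i : Set ((Bool × Fin T × Fin N) ⊕ Fin M → Example d)) ≤
      Real.exp (-(N * ε ^ 2 / 120)) := by
  have hY : Measurable fun p : Vec d × Example d =>
      (errorSet c p.1).indicator (fun z => (inner ℝ z.1 (perp p.1 v) : ℝ)) p.2 :=
    measurable_errorSet_indicator hc (f := fun p => inner ℝ p.2.1 (perp p.1 v))
      ((measurable_snd.fst).inner ((measurable_perp v).comp measurable_fst))
  refine measureReal_pi_fresh_sum_ge_le D (batchEmb T N M b i) (measurable_traj hc β w b i)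
    (fun ω ω' h => traj_congr c β w b i fun i' hi' => ?_)
    -- If `perp x v = 0`, both sides of the deviation inequality vanish and it would hold with
    -- certainty; such pasts are excluded.
    (P := {x | 0 < ‖perp x v‖}) (measurableSet_lt measurable_const (measurable_perp v).norm)
    (Y := fun x => (errorSet c x).indicator fun z => inner ℝ z.1 (perp x v)) hY
    (θ := fun x => N * (∫ z, (errorSet c x).indicator (fun z => inner ℝ z.1 (perp x v)) z ∂D
        + ‖perp x v‖ * ε))
    ?_ (Real.exp_pos _).le fun x hx => measureReal_pi_gradient_deviation_le hD hc hx hε hε1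
  · ext1 j
    apply h
    rintro ⟨j', hj'⟩
    have hj : (b, i, j') = (b, i', j) := Sum.inl_injective (β := Fin M) hj'
    rw [show i = i' from congrArg (fun p => p.2.1) hj] at hi'
    exact lt_irrefl _ hi'
  · exact ((hY.stronglyMeasurable.integral_prod_right).measurable.add
      ((measurable_perp v).norm.mul_const _)).const_mul _

/-- A batch with unusually long vectors. -/
def longBatch (T N M : ℕ) (b : Bool) (i : Fin T) :
    Set ((Bool × Fin T × Fin N) ⊕ Fin M → Example d) :=
  {ω | N * (4 * d : ℝ) ≤ ∑ j, ‖(batchAt ω b i j).1‖ ^ 2}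

lemma measureReal_longBatch_le (hD : D.fst = stdGaussian (Vec d)) (b : Bool) (i : Fin T) :
    (Measure.pi fun _ => D).real
      (longBatch T N M b i : Set ((Bool × Fin T × Fin N) ⊕ Fin M → Example d)) ≤
      Real.exp (-(N * d / 2 : ℝ)) := by
  have h := measureReal_pi_fresh_sum_ge_le D (batchEmb T N M b i) (g := fun _ => ())
    measurable_const (fun _ _ _ => rfl) (P := Set.univ) MeasurableSet.univ
    (Y := fun _ z => ‖z.1‖ ^ 2) (by fun_prop) (θ := fun _ => N * (4 * d : ℝ)) measurable_const
    (Real.exp_pos (-(N * d / 2 : ℝ))).le (fun _ _ => by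
      simpa using measureReal_pi_sum_norm_sq_ge_le (ι := Fin N) hD)
  simp only [Set.mem_univ, true_and] at h
  exact h

/-- A large deviation of the empirical error of one iterate, upwards for `σ = 1` and downwards for
`σ = -1`. -/
def validDeviation (D : Measure (Example d)) (c : Classifier d) (β : ℝ) (w : Vec d) (η σ : ℝ)
    (b : Bool) (i : Fin T) : Set ((Bool × Fin T × Fin N) ⊕ Fin M → Example d) :=
  {ω | M * (σ * D.real (errorSet c (traj c β w b ω (i + 1))) + η) ≤
    ∑ j, σ * (errorSet c (traj c β w b ω (i + 1))).indicator (fun _ => (1 : ℝ)) (ω (Sum.inr j))}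

/-- The summands are bounded by 1, so `Z = 1` is a majorant with `exp 2 ≤ 15`, and the validation
set is fresh for the iterate. -/
lemma measureReal_validDeviation_le {c : Classifier d} (hc : Measurable c) (β : ℝ) (w : Vec d)
    {η σ : ℝ} (hη : 0 ≤ η) (hη1 : η ≤ 60) (hσ : |σ| = 1) (b : Bool)
    (i : Fin T) : (Measure.pi fun _ => D).real
      (validDeviation D c β w η σ b i : Set ((Bool × Fin T × Fin N) ⊕ Fin M → Example d)) ≤
      Real.exp (-(M * η ^ 2 / 120)) := by
  have hY : Measurable fun p : Vec d × Example d =>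
      σ * (errorSet c p.1).indicator (fun _ => (1 : ℝ)) p.2 :=
    (measurable_errorSet_indicator hc (f := fun _ => 1) measurable_const).const_mul σ
  have herr : Measurable fun x : Vec d => D.real (errorSet c x) :=
    (measurable_measure_prodMk_left (measurableSet_errorSet_uncurry hc)).ennreal_toReal
  have h := measureReal_pi_fresh_sum_ge_le D
    (⟨Sum.inr, Sum.inr_injective⟩ : Fin M ↪ (Bool × Fin T × Fin N) ⊕ Fin M)
    (measurable_traj hc β w b (i + 1))
    (fun ω ω' h => traj_congr c β w b (i + 1) fun i' hi' => by ext1 j; exact h _ (by simp))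
    (P := Set.univ) MeasurableSet.univ
    (Y := fun x z => σ * (errorSet c x).indicator (fun _ => (1 : ℝ)) z) hY
    (θ := fun x => M * (σ * D.real (errorSet c x) + η))
    (((herr.const_mul σ).add_const η).const_mul (M : ℝ))
    (Real.exp_pos (-(M * η ^ 2 / 120))).le (fun x _ => by
      have hm := measurableSet_errorSet hc x
      have h1 := measureReal_pi_sum_ge_mean_add_le (μ := D) (ι := Fin M)
        (Y := fun z => σ * (errorSet c x).indicator (fun _ => (1 : ℝ)) z) (Z := fun _ => 1)
        ((measurable_const.indicator hm).const_mul σ) (fun z => by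
          rw [abs_mul, hσ, one_mul]
          by_cases hz : z ∈ errorSet c x <;> simp [hz]) (integrable_const _) (by
          have h : Real.exp (2 * 1) = Real.exp 1 * Real.exp 1 := by
            rw [← Real.exp_add]; norm_num
          simp only [integral_const, probReal_univ, one_smul]
          rw [h]
          nlinarith [Real.exp_one_lt_d9, Real.exp_pos 1]) hη hη1
      rw [integral_const_mul, integral_indicator_const _ hm, Fintype.card_fin] at h1
      simpa using h1)
  simp only [Set.mem_univ, true_and] at h
  exact h

end Probability

/-! ### Bounds for `T`, `N`, `M` and the total costs. -/

section Sizes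

variable {d m : ℕ} {ε δ : ℝ}

lemma one_le_log_inv (hε : 0 < ε) (hε1 : ε ≤ 1 / Real.exp 1) : 1 ≤ Real.log (1 / ε) := by
  rw [Real.le_log_iff_exp_le (by positivity)]
  rwa [le_div_iff₀ hε, mul_comm, ← le_div_iff₀ (Real.exp_pos 1)]

lemma le_half_of_le_inv_exp (hε1 : ε ≤ 1 / Real.exp 1) : ε ≤ 1 / 2 :=
  hε1.trans (one_div_le_one_div_of_le (by norm_num) (by linarith [Real.exp_one_gt_d9]))

lemma four_mul_le_numIter (hε : 0 < ε) (hδ : 0 < δ) (hδ1 : δ < 1) (hm : 0 < m) :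
    4 * (d : ℝ) ≤ numIter d m ε δ * ε ^ 4 := by
  have hm' : (1 : ℝ) ≤ m := by exact_mod_cast hm
  have h1 : 0 ≤ Real.log (8 * (m : ℝ) / δ) := by
    apply Real.log_nonneg
    rw [le_div_iff₀ hδ]; linarith
  have h2 : (4 * (d : ℝ) + Real.log (8 * (m : ℝ) / δ)) / ε ^ 4 ≤ numIter d m ε δ :=
    Nat.le_ceil _
  rw [div_le_iff₀ (by positivity)] at h2
  linarith

lemma numIter_pos (hd : 0 < d) (hε : 0 < ε) (hδ : 0 < δ) (hδ1 : δ < 1) (hm : 0 < m) :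
    0 < numIter d m ε δ := by
  have h := four_mul_le_numIter (d := d) hε hδ hδ1 hm
  have hd' : (0 : ℝ) < d := by exact_mod_cast hd
  by_contra h0
  have h0' : numIter d m ε δ = 0 := by omega
  rw [h0'] at h
  simp only [Nat.cast_zero, zero_mul] at h
  linarith

lemma one_le_log_mul_div {T : ℕ} (hδ : 0 < δ) (hδ1 : δ < 1) (hm : 0 < m) (hT : 0 < T) :
    1 ≤ Real.log (4 * (m : ℝ) * T / δ) := by
  have hm' : (1 : ℝ) ≤ m := by exact_mod_cast hm
  have hT' : (1 : ℝ) ≤ T := by exact_mod_cast hT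
  have h : 4 ≤ 4 * (m : ℝ) * T / δ := by
    rw [le_div_iff₀ hδ]
    nlinarith
  rw [Real.le_log_iff_exp_le (by linarith)]
  linarith [Real.exp_one_lt_d9]

lemma log_four_le_log_sixteen {T : ℕ} (hδ : 0 < δ) (hm : 0 < m) (hT : 0 < T) :
    Real.log (4 * (m : ℝ) * T / δ) ≤ Real.log (16 * (T : ℝ) * m / δ) := by
  have hm' : (0 : ℝ) < m := by exact_mod_cast hm
  have hT' : (0 : ℝ) < T := by exact_mod_cast hT
  apply Real.log_le_log (by positivity)
  gcongr ?_ / _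
  nlinarith [mul_pos hm' hT']

/-- One power of the logarithm suffices for the deviation bounds; the second is discarded because
the logarithm is at least 1. -/
lemma le_batchSize (hε : 0 < ε) (hδ : 0 < δ) (hδ1 : δ < 1) (hm : 0 < m)
    (hT : 0 < numIter d m ε δ) :
    1600 * Real.log (16 * (numIter d m ε δ : ℝ) * (m : ℝ) / δ) ≤ batchSize d m ε δ * ε ^ 2 := by
  have h1 := (one_le_log_mul_div hδ hδ1 hm hT).trans (log_four_le_log_sixteen hδ hm hT)
  have h2 : 1600 * Real.log (16 * (numIter d m ε δ : ℝ) * (m : ℝ) / δ) ^ 2 / ε ^ 2 ≤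
      batchSize d m ε δ := Nat.le_ceil _
  rw [div_le_iff₀ (by positivity)] at h2
  nlinarith

lemma le_validSize (hε : 0 < ε) :
    Real.log (4 * (m : ℝ) * (numIter d m ε δ : ℝ) / δ) ≤ validSize d m ε δ * (2 * ε) := by
  have h : Real.log (4 * (m : ℝ) * (numIter d m ε δ : ℝ) / δ) / (2 * ε) ≤ validSize d m ε δ :=
    Nat.le_ceil _
  rwa [div_le_iff₀ (by positivity)] at h

lemma nat_ceil_le_add_one {a : ℝ} (ha : 0 ≤ a) : (⌈a⌉₊ : ℝ) ≤ a + 1 := (Nat.ceil_lt_add_one ha).le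

/-- Upper bounds for the sample sizes. -/
lemma sizes_le (hd : 0 < d) (hm : 0 < m) (hε : 0 < ε) (hε1 : ε ≤ 1 / Real.exp 1) (hδ : 0 < δ)
    (hδ1 : δ < 1) {L : ℝ} (hL : L = Real.log ((d : ℝ) * m / (ε * δ))) :
    1 ≤ L ∧ (numIter d m ε δ : ℝ) ≤ 9 * (d * L / ε ^ 4) ∧
      (batchSize d m ε δ : ℝ) ≤ 160001 * (L ^ 2 / ε ^ 2) ∧
      (validSize d m ε δ : ℝ) ≤ 6 * (L / ε) := by
  have hd' : (1 : ℝ) ≤ d := by exact_mod_cast hd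
  have hm' : (1 : ℝ) ≤ m := by exact_mod_cast hm
  have hε2 := le_half_of_le_inv_exp hε1
  have hε4 : ε ^ 4 ≤ 1 := pow_le_one₀ hε.le (by linarith)
  set Q := (d : ℝ) * m / (ε * δ) with hQ
  have hQ1 : 1 / ε ≤ Q := by
    rw [hQ, div_le_div_iff₀ hε (by positivity)]
    have : 1 ≤ (d : ℝ) * m := by nlinarith
    nlinarith
  have hL1 : 1 ≤ L := by
    rw [hL]
    exact (one_le_log_inv hε hε1).trans (Real.log_le_log (by positivity) hQ1)
  have hQ0 : 0 < Q := by positivity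
  have hQ1' : 1 ≤ Q := le_trans (by rw [le_div_iff₀ hε]; linarith) hQ1
  have hexp : Real.exp L = Q := by rw [hL, Real.exp_log hQ0]
  have hmδ : m / δ ≤ Q := by
    rw [hQ, div_le_div_iff₀ hδ (by positivity)]
    have : ε ≤ (d : ℝ) := by linarith
    have : ε * (m * δ) ≤ d * (m * δ) := by gcongr
    linarith
  have hlog8 : Real.log (8 * (m : ℝ) / δ) ≤ 4 * L := by
    have h8 : 8 * (m : ℝ) / δ ≤ Real.exp (3 + L) := by
      rw [Real.exp_add, hexp, mul_div_assoc]
      have : 8 ≤ Real.exp 3 := by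
        have h : Real.exp 3 = Real.exp 1 ^ 3 := by rw [← Real.exp_nat_mul]; norm_num
        rw [h]
        calc (8 : ℝ) = 2 ^ 3 := by norm_num
          _ ≤ _ := by gcongr; linarith [Real.exp_one_gt_d9]
      gcongr
    have := (Real.log_le_iff_le_exp (by positivity)).2 h8
    linarith
  have hlog8' : 0 ≤ Real.log (8 * (m : ℝ) / δ) := by
    apply Real.log_nonneg
    rw [le_div_iff₀ hδ]; linarith
  have hT : (numIter d m ε δ : ℝ) ≤ 9 * (d * L / ε ^ 4) := by
    refine (nat_ceil_le_add_one (by positivity)).trans ?_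
    have h1 : (4 * (d : ℝ) + Real.log (8 * (m : ℝ) / δ)) / ε ^ 4 + 1 ≤
        (4 * (d * L) + 4 * (d * L) + d * L) / ε ^ 4 := by
      rw [div_add_one (by positivity)]
      have : 1 ≤ (d : ℝ) * L := by nlinarith
      have : (d : ℝ) ≤ d * L := by nlinarith
      have : L ≤ d * L := by nlinarith
      gcongr
      · linarith
      · linarith
    refine h1.trans (le_of_eq ?_)
    ring
  have hTpos := numIter_pos (d := d) hd hε hδ hδ1 hm
  have hTpos' : (0 : ℝ) < numIter d m ε δ := by exact_mod_cast hTpos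
  set Λ := Real.log (16 * (numIter d m ε δ : ℝ) * (m : ℝ) / δ)
  have hΛ1 := (one_le_log_mul_div hδ hδ1 hm hTpos).trans (log_four_le_log_sixteen hδ hm hTpos)
  have hΛ : Λ ≤ 10 * L := by
    -- Inserting `T ≤ 9dL/ε⁴` gives `144 L Q ε⁻³`, and both `L` and `1/ε` are at most `Q = exp L`.
    have h1 : 16 * (numIter d m ε δ : ℝ) * (m : ℝ) / δ ≤ Real.exp (5 + 5 * L) := by
      have h5 : Real.exp (5 + 5 * L) = Real.exp 5 * Q ^ 5 := by
        rw [Real.exp_add, ← hexp, ← Real.exp_nat_mul]; norm_num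
      have h144 : 144 ≤ Real.exp 5 := by
        have h : Real.exp 5 = Real.exp 1 ^ 5 := by rw [← Real.exp_nat_mul]; norm_num
        rw [h]
        calc (144 : ℝ) ≤ 2.718 ^ 5 := by norm_num
          _ ≤ _ := by gcongr; linarith [Real.exp_one_gt_d9]
      have hLQ : L ≤ Q := by rw [← hexp]; linarith [Real.add_one_le_exp L]
      have hQd : (d : ℝ) * (m / δ) = Q * ε := by
        rw [hQ]; field_simp
      have hQε : (1 / ε) ^ 3 ≤ Q ^ 3 := by gcongr
      rw [h5]
      calc 16 * (numIter d m ε δ : ℝ) * (m : ℝ) / δ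
          ≤ 16 * (9 * (d * L / ε ^ 4)) * m / δ := by gcongr
        _ = 144 * (L * (d * (m / δ)) * (1 / ε) ^ 4) := by ring
        _ = 144 * (L * Q * (1 / ε) ^ 3) := by rw [hQd]; field_simp
        _ ≤ Real.exp 5 * (Q * Q * Q ^ 3) := by gcongr
        _ = _ := by ring
    have := (Real.log_le_iff_le_exp (by positivity)).2 h1
    change Λ ≤ _ at this
    linarith
  have hε2' : ε ^ 2 ≤ 1 := pow_le_one₀ hε.le (by linarith)
  refine ⟨hL1, hT, ?_, ?_⟩
  · refine (nat_ceil_le_add_one (by positivity)).trans ?_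
    rw [div_add_one (by positivity), ← mul_div_assoc]
    have h1 : Λ ^ 2 ≤ (10 * L) ^ 2 := pow_le_pow_left₀ (by linarith) hΛ 2
    have h2 : 1 ≤ L ^ 2 := one_le_pow₀ hL1
    gcongr
    linarith
  · have h0 := one_le_log_mul_div hδ hδ1 hm hTpos
    refine (nat_ceil_le_add_one (by positivity)).trans ?_
    rw [div_add_one (by positivity), ← mul_div_assoc, div_le_div_iff₀ (by positivity) hε]
    have h1 := (log_four_le_log_sixteen hδ hm hTpos).trans hΛ
    have h2 : Real.log (4 * (m : ℝ) * (numIter d m ε δ : ℝ) / δ) + 2 * ε ≤ 12 * L := by linarith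
    calc _ ≤ 12 * L * ε := by gcongr
      _ = _ := by ring

/-- The product `TN` has order `A = dL³/ε⁶`; all other costs are smaller monomials in `d`, `1/ε` and
`L`, all at least 1, and are absorbed. -/
lemma sizes_products_le (hd : 0 < d) (hm : 0 < m) (hε : 0 < ε) (hε1 : ε ≤ 1 / Real.exp 1)
    (hδ : 0 < δ) (hδ1 : δ < 1) {A : ℝ}
    (hA : A = d / ε ^ 6 * Real.log ((d : ℝ) * m / (ε * δ)) ^ 3) :
    1 ≤ A ∧ (numIter d m ε δ : ℝ) * batchSize d m ε δ ≤ 1440009 * A ∧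
      (numIter d m ε δ : ℝ) * validSize d m ε δ ≤ 54 * A ∧
      (numIter d m ε δ : ℝ) ≤ 9 * A ∧ (validSize d m ε δ : ℝ) ≤ 6 * A := by
  obtain ⟨hL, hT, hN, hM⟩ := sizes_le hd hm hε hε1 hδ hδ1 rfl
  set L := Real.log ((d : ℝ) * m / (ε * δ))
  have hd' : (1 : ℝ) ≤ d := by exact_mod_cast hd
  have hε2 := le_half_of_le_inv_exp hε1
  have hx : 1 ≤ 1 / ε := by rw [le_div_iff₀ hε]; linarith
  set x := 1 / ε
  have hL0 : 0 ≤ L := by linarith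
  have hA' : A = d * x ^ 6 * L ^ 3 := by rw [hA]; simp only [x]; ring
  have hT' : (numIter d m ε δ : ℝ) ≤ 9 * (d * L * x ^ 4) := by
    convert hT using 1; simp only [x]; ring
  have hN' : (batchSize d m ε δ : ℝ) ≤ 160001 * (L ^ 2 * x ^ 2) := by
    convert hN using 1; simp only [x]; ring
  have hM' : (validSize d m ε δ : ℝ) ≤ 6 * (L * x) := by
    convert hM using 1; simp only [x]; ring
  have hmono : ∀ {e a b : ℕ}, e ≤ 1 → a ≤ 6 → b ≤ 3 → (d : ℝ) ^ e * x ^ a * L ^ b ≤ A := by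
    intro e a b he ha hb
    rw [hA']
    calc (d : ℝ) ^ e * x ^ a * L ^ b ≤ (d : ℝ) ^ 1 * x ^ 6 * L ^ 3 := by gcongr
      _ = _ := by ring
  have hprod : d * L * x ^ 4 * (L * x) ≤ A := by
    refine le_trans (le_of_eq ?_) (hmono (e := 1) (a := 5) (b := 2) le_rfl (by norm_num)
      (by norm_num))
    ring
  refine ⟨?_, ?_, ?_, ?_, ?_⟩
  · simpa using hmono (e := 0) (a := 0) (b := 0) (by norm_num) (by norm_num) (by norm_num)
  · calc _ ≤ 9 * (d * L * x ^ 4) * (160001 * (L ^ 2 * x ^ 2)) := by gcongr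
      _ = _ := by rw [hA']; ring
  · calc _ ≤ 9 * (d * L * x ^ 4) * (6 * (L * x)) := by gcongr
      _ = 54 * (d * L * x ^ 4 * (L * x)) := by ring
      _ ≤ _ := by gcongr
  · have := hmono (e := 1) (a := 4) (b := 1) le_rfl (by norm_num) (by norm_num)
    simp only [pow_one] at this
    linarith
  · have := hmono (e := 0) (a := 1) (b := 1) (by norm_num) (by norm_num) (by norm_num)
    simp only [pow_zero, pow_one, one_mul] at this
    linarith

lemma card_drawIdx_le (hd : 0 < d) (hm : 0 < m) (hε : 0 < ε) (hε1 : ε ≤ 1 / Real.exp 1)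
    (hδ : 0 < δ) (hδ1 : δ < 1) :
    (Fintype.card (DrawIdx d m ε δ) : ℝ) ≤
      10 ^ 8 * (d / ε ^ 6 * Real.log ((d : ℝ) * m / (ε * δ)) ^ 3) := by
  obtain ⟨h1, h2, h3, h4, h5⟩ := sizes_products_le hd hm hε hε1 hδ hδ1 rfl
  rw [card_drawIdx]
  push_cast
  linarith

lemma steps_ccfc_real_le (hd : 0 < d) (hε : 0 < ε) (hε1 : ε ≤ 1 / Real.exp 1)
    (hδ : 0 < δ) (hδ1 : δ < 1) (cs : List (Classifier d)) (hm : 0 < cs.length) (w₀ : Vec d)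
    (ω : DrawIdx d cs.length ε δ → Example d) :
    ((ccfc cs w₀ ε δ ω).steps : ℝ) ≤ 10 ^ 8 * (cs.length *
      (d / ε ^ 6 * Real.log ((d : ℝ) * cs.length / (ε * δ)) ^ 3)) := by
  obtain ⟨h1, h2, h3, h4, h5⟩ := sizes_products_le hd hm hε hε1 hδ hδ1 rfl
  have h := steps_ccfc_le cs w₀ ε δ ω rfl rfl rfl
  have h' : ((ccfc cs w₀ ε δ ω).steps : ℝ) ≤ _ := Nat.cast_le.2 h
  refine h'.trans ?_
  set A := d / ε ^ 6 * Real.log ((d : ℝ) * cs.length / (ε * δ)) ^ 3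
  have hm' : (1 : ℝ) ≤ cs.length := by exact_mod_cast hm
  set m : ℝ := (cs.length : ℝ)
  push_cast
  -- The dominant term is `32 · 1440009 ≈ 4.6 · 10⁷`.
  have e1 : (numIter d cs.length ε δ : ℝ) * (32 * batchSize d cs.length ε δ +
      12 * validSize d cs.length ε δ + 27) + 6 * validSize d cs.length ε δ + 8 ≤
      5 * 10 ^ 7 * A := by linarith
  have e2 := mul_le_mul_of_nonneg_left e1 (by linarith : 0 ≤ m)
  have e3 : A ≤ m * A := le_mul_of_one_le_left (by linarith) hm'
  linarith

end Sizes

/-! ### Correctness outside the deviation events. -/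

section Correctness

variable {d T N M : ℕ} {D : Measure (Example d)}

/-- The output of the algorithm when all empirical errors are accurate. -/
lemma ccfc_val_of_accurate {ε δ : ℝ} {cs : List (Classifier d)} {w₀ : Vec d}
    {ω : DrawIdx d cs.length ε δ → Example d}
    (hT : 0 < numIter d cs.length ε δ) {η : ℝ}
    (hacc : ∀ c ∈ cs, ∀ w ∈ iterates (batchesOf ω true) (batchesOf ω false) w₀ c,
      |(empErr (validOf ω) c w).val - D.real (errorSet c w)| ≤ η)
    {c : Classifier d} (hc : c ∈ cs) {w : Vec d}
    (hw : w ∈ iterates (batchesOf ω true) (batchesOf ω false) w₀ c) :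
    ∃ c' ∈ cs, ∃ w' ∈ iterates (batchesOf ω true) (batchesOf ω false) w₀ c',
      (ccfc cs w₀ ε δ ω).val = some (c', w') ∧
        D.real (errorSet c' w') ≤ D.real (errorSet c w) + 2 * η := by
  have hne : ∀ c ∈ cs, iterates (batchesOf ω true) (batchesOf ω false) w₀ c ≠ [] := by
    intro c _
    exact List.ne_nil_of_mem ((mem_iterates_iff ω w₀ c _).2 ⟨true, ⟨0, hT⟩, rfl⟩)
  obtain ⟨k1, k2⟩ := mem_candidates (S := validOf ω) hne
  obtain ⟨w'', hmem, hle⟩ := k2 c hc w hw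
  obtain ⟨p, hp, hval, hmin⟩ := argminList_spec
    (fun p : Classifier d × Vec d => empErr (validOf ω) p.1 p.2) _ (List.ne_nil_of_mem hmem)
  obtain ⟨hp1, hp2⟩ := k1 p hp
  refine ⟨p.1, hp1, p.2, hp2, ?_, ?_⟩
  · simp only [ccfc, Timed.val_bind, val_step]
    rw [hval]
    rfl
  · have a1 := (abs_le.1 (hacc p.1 hp1 p.2 hp2)).1
    have a2 := (abs_le.1 (hacc c hc w hw)).2
    have a3 := hmin _ hmem
    simp only at a3
    linarith

lemma abs_empErr_sub_le_of_notMem_validDeviation {ε δ : ℝ} {m : ℕ} {w₀ : Vec d}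
    {ω : DrawIdx d m ε δ → Example d} (hM : 0 < validSize d m ε δ) {η : ℝ} {c : Classifier d}
    (h : ∀ b i, ω ∉ validDeviation D c (stepSize (numIter d m ε δ) d) (startVec w₀ b) η 1 b i ∧
      ω ∉ validDeviation D c (stepSize (numIter d m ε δ) d) (startVec w₀ b) η (-1) b i)
    {w : Vec d} (hw : w ∈ iterates (batchesOf ω true) (batchesOf ω false) w₀ c) :
    |(empErr (validOf ω) c w).val - D.real (errorSet c w)| ≤ η := by
  obtain ⟨b, i, rfl⟩ := (mem_iterates_iff ω w₀ c w).1 hw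
  obtain ⟨h1', h2'⟩ := h b i
  have hM' : (0 : ℝ) < validSize d m ε δ := by exact_mod_cast hM
  rw [val_empErr_validOf]
  simp only [validDeviation, Set.mem_ofPred_eq, not_le] at h1' h2'
  rw [← Finset.mul_sum] at h1' h2'
  rw [one_mul, one_mul, ← div_lt_iff₀' hM'] at h1'
  rw [neg_one_mul, neg_one_mul, ← div_lt_iff₀' hM', neg_div] at h2'
  rw [abs_le]
  constructor <;> linarith

variable [IsProbabilityMeasure D]

/-- Without large deviations, one of the iterates has small error. -/
lemma exists_traj_error_le (hD : D.fst = stdGaussian (Vec d)) {c : Classifier d}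
    (hc : Measurable c) {w v : Vec d} (hw : ‖w‖ = 1) (hv1 : ‖v‖ = 1) (hwv : 0 ≤ inner ℝ w v)
    {ε : ℝ} (hε : 0 < ε) (hε1 : ε ≤ 1 / Real.exp 1) (hv : D.real (errorSet c v) ≤ ε)
    (hd : 0 < d) (hT : 4 * d ≤ T * ε ^ 4) (hN : 0 < N) (b : Bool)
    {ω : (Bool × Fin T × Fin N) ⊕ Fin M → Example d}
    (h1 : ∀ i, ω ∉ gradDeviation D c (stepSize T d) w v ε b i)
    (h2 : ∀ i, ω ∉ longBatch T N M b i) :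
    ∃ i : Fin T, D.real (errorSet c (traj c (stepSize T d) w b ω (i + 1))) ≤
      16 * √ε * Real.log (1 / ε) := by
  set β := stepSize T d with hβ
  have hd' : (0 : ℝ) < d := by exact_mod_cast hd
  have hN' : (0 : ℝ) < N := by exact_mod_cast hN
  set L := Real.log (1 / ε) with hL
  have hL1 : 1 ≤ L := one_le_log_inv hε hε1
  have hε2 := le_half_of_le_inv_exp hε1
  set W : ℕ → Vec d := fun i => traj c β w b ω i with hW
  set G : ℕ → Vec d := fun i => if h : i < T then gradMean c (W i) (batchAt ω b ⟨i, h⟩) else 0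
    with hG
  have hGi : ∀ i (h : i < T), G i = gradMean c (W i) (batchAt ω b ⟨i, h⟩) :=
    fun i h => dif_pos h
  have hnormG : ∀ i < T, ‖W i‖ = 1 → ‖G i‖ ^ 2 ≤ 4 * d := by
    intro i hi hwi
    rw [hGi i hi]
    exact norm_gradMean_sq_le c hN hwi (not_le.1 (h2 ⟨i, hi⟩)).le
  have horth : ∀ i < T, ‖W i‖ = 1 → inner ℝ (G i) (W i) = 0 := by
    intro i hi hwi
    rw [hGi i hi]
    exact inner_gradMean_self c hwi _
  have hstep : ∀ i < T, W (i + 1) = ‖W i - β • G i‖⁻¹ • (W i - β • G i) := by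
    intro i hi
    rw [hGi i hi]
    exact traj_succ c β w b ω ⟨i, hi⟩
  -- The good index may be 0, but `w(0)` is not among the candidates.
  obtain ⟨i, hi, hgood⟩ := exists_not_bad_of_drift (w := W) (g := G)
    (Bad := fun x => 11 * √ε * L < D.real (errorSet c x)) hd hT hε hβ hv1 hw hwv hstep horth hnormG
    (fun i hi hwi hwv' hbad => by
      obtain ⟨hs, hdr⟩ := drift_of_large_error hD hc hwi hv1 hwv' hε hε1 hv hbad
      have h := h1 ⟨i, hi⟩
      have h3 := lt_of_not_ge fun h' => h ⟨hs, h'⟩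
      rw [hGi i hi, inner_gradMean c hwi, inv_mul_le_iff₀ hN']
      exact h3.le.trans (by gcongr))
  rw [not_lt] at hgood
  have hq0 : 0 < √ε := Real.sqrt_pos.2 hε
  -- For index 0, `w(1)` is within `ε²` of `w(0)`, since `4dβ² ≤ ε⁴`. Moving to it costs at most
  -- `5√ε log(1/ε)`, which raises the constant from 11 to 16.
  rcases i with _ | i
  · refine ⟨⟨0, hi⟩, ?_⟩
    change D.real (errorSet c (W 1)) ≤ _
    have hw1 : ‖W 1‖ = 1 := norm_traj c β hw b ω 1
    have hw0 : ‖W 0‖ = 1 := hw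
    have e1 := measureReal_errorSet_le_add (D := D) c (W 1) (W 0)
    have e2 := measureReal_halfspace_diff_le hD (w := W 1) (v := W 0) hw1 (L := L) (by linarith)
    have hexp : Real.exp (-L) = ε := by
      rw [hL, one_div, Real.log_inv, neg_neg, Real.exp_log hε]
    rw [hexp] at e2
    have e3 : ‖W 0 - W 1‖ ≤ ε ^ 2 := by
      have hT' : (0 : ℝ) < T := by exact_mod_cast hi
      have e4 := norm_normalize_sub_sq_le (one_le_norm_sub_smul hw0 (horth 0 hi hw0) β) hw0.le
      rw [← hstep 0 hi, sub_sub_cancel_left, norm_neg, norm_smul, mul_pow, Real.norm_eq_abs, sq_abs]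
        at e4
      have e5 := hnormG 0 hi hw0
      have hβ2 : β ^ 2 * (T * d) = 1 := by
        rw [hβ, stepSize, Real.sq_sqrt (by positivity)]; field_simp
      rw [norm_sub_rev]
      apply le_of_sq_le_sq _ (by positivity)
      refine e4.trans ((mul_le_mul_of_nonneg_left e5 (sq_nonneg β)).trans ?_)
      calc β ^ 2 * (4 * d) ≤ β ^ 2 * (T * ε ^ 4) := by gcongr
        _ ≤ β ^ 2 * (T * ε ^ 4) * d := le_mul_of_one_le_right (by positivity)
            (by exact_mod_cast hd)
        _ = β ^ 2 * (T * d) * ε ^ 4 := by ring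
        _ = _ := by rw [hβ2]; ring
    have hqε : √ε * √ε = ε := Real.mul_self_sqrt hε.le
    have hq1 : √ε ≤ 1 := Real.sqrt_le_one.2 (by linarith)
    have e6 : ε ≤ √ε := hqε.symm.le.trans (mul_le_of_le_one_left hq0.le hq1)
    have e7 : √ε ≤ √ε * L := le_mul_of_one_le_right hq0.le hL1
    have e8 : ‖W 0 - W 1‖ * L ≤ √ε * L := by
      gcongr
      exact e3.trans ((by nlinarith : ε ^ 2 ≤ ε).trans e6)
    linarith
  · refine ⟨⟨i, by omega⟩, hgood.trans ?_⟩
    gcongr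
    norm_num

/-- The probability of a large deviation anywhere in the run of the algorithm. -/
lemma measureReal_deviations_le (hD : D.fst = stdGaussian (Vec d)) (hd : 0 < d) {ε δ : ℝ}
    (hε : 0 < ε) (hε1 : ε ≤ 1 / Real.exp 1) (hδ : 0 < δ) (hδ1 : δ < 1)
    (C : Finset (Classifier d)) (hC : ∀ c ∈ C, Measurable c) {m : ℕ} (hm : m = C.card)
    {c : Classifier d} (hc : c ∈ C) (w₀ v : Vec d) (b : Bool) :
    (Measure.pi fun _ : DrawIdx d m ε δ => D).real
      ((⋃ i, gradDeviation D c (stepSize (numIter d m ε δ) d) (startVec w₀ b) v ε b i) ∪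
        (⋃ i, longBatch _ _ _ b i) ∪
        ⋃ x : C × Bool × Fin (numIter d m ε δ) × Bool,
          validDeviation D x.1.1 (stepSize (numIter d m ε δ) d) (startVec w₀ x.2.1) (22 * √ε)
            (if x.2.2.2 then 1 else -1) x.2.1 x.2.2.1) ≤ δ := by
  have hm0 : 0 < m := hm ▸ Finset.card_pos.2 ⟨c, hc⟩
  have hT0 := numIter_pos (d := d) hd hε hδ hδ1 hm0
  have hN := le_batchSize (d := d) hε hδ hδ1 hm0 hT0
  have hM := le_validSize (d := d) (m := m) (δ := δ) hε
  set T := numIter d m ε δ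
  set N := batchSize d m ε δ
  set M := validSize d m ε δ
  have hl1 := one_le_log_mul_div hδ hδ1 hm0 hT0
  have hl2 := log_four_le_log_sixteen hδ hm0 hT0
  have hε2 := le_half_of_le_inv_exp hε1
  have hd1 : (1 : ℝ) ≤ d := by exact_mod_cast hd
  have hm1 : (0 : ℝ) < m := by exact_mod_cast hm0
  have hm2 : (1 : ℝ) ≤ m := by exact_mod_cast hm0
  have hT1 : (0 : ℝ) < T := by exact_mod_cast hT0
  have hT2 : (1 : ℝ) ≤ T := by exact_mod_cast hT0
  set Λ := Real.log (16 * (T : ℝ) * m / δ) with hΛ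
  set l := Real.log (4 * (m : ℝ) * T / δ) with hl
  have hexpΛ : Real.exp (-Λ) = δ / (16 * T * m) := by
    rw [hΛ, Real.exp_neg, Real.exp_log (by positivity), inv_div]
  have hexpl : Real.exp (-l) = δ / (4 * m * T) := by
    rw [hl, Real.exp_neg, Real.exp_log (by positivity), inv_div]
  have q1 : Real.exp (-(N * ε ^ 2 / 120)) ≤ δ / (16 * T * m) := by
    rw [← hexpΛ]; gcongr; linarith
  have q2 : Real.exp (-(N * d / 2 : ℝ)) ≤ δ / (16 * T * m) := by
    rw [← hexpΛ]
    gcongr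
    have e1 : (N : ℝ) * ε ^ 2 ≤ N * 1 := by
      gcongr
      exact pow_le_one₀ hε.le (by linarith)
    have e2 : (N : ℝ) * 1 ≤ N * d := by gcongr
    linarith
  have q3 : Real.exp (-(M * (22 * √ε) ^ 2 / 120)) ≤ δ / (16 * T * m) := by
    -- With `2εM ≥ l`, the constant 22 is enough because `22² / 240 > 2`.
    have e1 : 2 * l ≤ M * (22 * √ε) ^ 2 / 120 := by
      rw [mul_pow, Real.sq_sqrt hε.le]
      nlinarith
    calc _ ≤ Real.exp (-l) * Real.exp (-l) := by
          rw [← Real.exp_add]; gcongr; linarith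
      _ ≤ Real.exp (-l) * (1 / 4) := by
          gcongr
          rw [hexpl, div_le_div_iff₀ (by positivity) (by norm_num)]
          nlinarith
      _ = δ / (16 * T * m) := by rw [hexpl]; field_simp; norm_num
  have hη : 22 * √ε ≤ 60 := by
    have : √ε ≤ 1 := Real.sqrt_le_one.2 (by linarith)
    linarith
  have hcard : Fintype.card (C × Bool × Fin T × Bool) = m * (2 * (T * 2)) := by
    simp [hm]
  have p1 := measureReal_iUnion_fintype_le (μ := Measure.pi fun _ : DrawIdx d m ε δ => D)
    fun i : Fin T => gradDeviation D c (stepSize T d) (startVec w₀ b) v ε b i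
  have p2 := measureReal_iUnion_fintype_le (μ := Measure.pi fun _ : DrawIdx d m ε δ => D)
    fun i : Fin T => longBatch T N M b i
  have p3 := measureReal_iUnion_fintype_le (μ := Measure.pi fun _ : DrawIdx d m ε δ => D)
    fun x : C × Bool × Fin T × Bool =>
      validDeviation D x.1.1 (stepSize T d) (startVec w₀ x.2.1) (22 * √ε)
            (if x.2.2.2 then 1 else -1) x.2.1 x.2.2.1
  have r1 := p1.trans (Finset.sum_le_card_nsmul _ _ _ fun i _ =>
    (measureReal_gradDeviation_le hD (hC c hc) _ (startVec w₀ b) v hε.le (by linarith) b i).trans q1)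
  have r2 := p2.trans (Finset.sum_le_card_nsmul _ _ _ fun i _ =>
    (measureReal_longBatch_le hD b i).trans q2)
  have r3 := p3.trans (Finset.sum_le_card_nsmul _ _ _ fun x _ =>
    (measureReal_validDeviation_le (hC x.1.1 x.1.2) _ (startVec w₀ x.2.1) (by positivity) hη
      (by split_ifs <;> simp) x.2.1 x.2.2.1).trans q3)
  rw [Finset.card_univ, nsmul_eq_mul] at r1 r2 r3
  rw [Fintype.card_fin] at r1 r2
  rw [hcard] at r3
  refine (measureReal_union_le _ _).trans ((add_le_add ((measureReal_union_le _ _).trans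
    (add_le_add r1 r2)) r3).trans ?_)
  -- Gradients are controlled only for the good classifier and one run, validation errors for all
  -- classifiers, runs, iterates and signs; the total is `δ/16 + δ/16 + δ/4`.
  have s1 : (T : ℝ) * (δ / (16 * T * m)) ≤ δ / 16 := by
    have : (T : ℝ) * (δ / (16 * T * m)) = δ / 16 / m := by field_simp
    rw [this]
    exact div_le_self (by positivity) hm2
  have s2 : ((m * (2 * (T * 2)) : ℕ) : ℝ) * (δ / (16 * T * m)) = δ / 4 := by
    push_cast; field_simp; norm_num
  linarith

/-- The algorithm succeeds outside an event of probability `δ`. -/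
lemma measure_ccfc_failure_le (hD : D.fst = stdGaussian (Vec d)) {ε δ : ℝ}
    (hε : 0 < ε) (hε1 : ε ≤ 1 / Real.exp 1) (hδ : 0 < δ) (hδ1 : δ < 1)
    (C : Finset (Classifier d)) (hC : ∀ c ∈ C, Measurable c) (cs : List (Classifier d))
    (hcs : (cs : Multiset (Classifier d)) = C.val) {w₀ v : Vec d} (hw₀ : ‖w₀‖ = 1) (hv1 : ‖v‖ = 1)
    (hd : 0 < d) {c : Classifier d} (hc : c ∈ C) (hv : D.real (errorSet c v) ≤ ε) :
    (Measure.pi fun _ : DrawIdx d cs.length ε δ => D)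
      {ω | ¬ ∃ c ∈ C, ∃ w : Vec d, ‖w‖ = 1 ∧ (ccfc cs w₀ ε δ ω).val = some (c, w) ∧
        D.real (errorSet c w) ≤ 60 * √ε * Real.log (1 / ε)} ≤ ENNReal.ofReal δ := by
  have hm : cs.length = C.card := by rw [Finset.card, ← hcs, Multiset.coe_card]
  have hmem : ∀ c, c ∈ cs ↔ c ∈ C := fun c => by
    rw [← Finset.mem_val, ← hcs, Multiset.mem_coe]
  have hm0 : 0 < cs.length := List.length_pos_of_mem ((hmem c).2 hc)
  obtain ⟨b, hb⟩ := exists_startVec_inner_nonneg w₀ v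
  have hT0 := numIter_pos (d := d) hd hε hδ hδ1 hm0
  have hT := four_mul_le_numIter (d := d) hε hδ hδ1 hm0
  have hl := one_le_log_mul_div hδ hδ1 hm0 hT0
  have hN : 0 < batchSize d cs.length ε δ := by
    have h := le_batchSize (d := d) hε hδ hδ1 hm0 hT0
    have := hl.trans (log_four_le_log_sixteen hδ hm0 hT0)
    by_contra h0
    rw [Nat.eq_zero_of_not_pos h0] at h
    simp only [Nat.cast_zero, zero_mul] at h
    linarith
  have hM : 0 < validSize d cs.length ε δ := by
    have h := le_validSize (d := d) (m := cs.length) (δ := δ) hε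
    by_contra h0
    rw [Nat.eq_zero_of_not_pos h0] at h
    simp only [Nat.cast_zero, zero_mul] at h
    linarith
  have hmeas := measureReal_deviations_le hD hd hε hε1 hδ hδ1 C hC hm hc w₀ v b
  rw [← ofReal_measureReal]
  -- Only monotonicity is used, so the failure event need not be measurable.
  refine ENNReal.ofReal_le_ofReal ((measureReal_mono ?_).trans hmeas)
  intro ω hω
  by_contra hout
  simp only [Set.mem_union, Set.mem_iUnion, not_or, not_exists] at hout
  obtain ⟨⟨h1, h2⟩, h3⟩ := hout
  apply hω
  obtain ⟨i, hi⟩ := exists_traj_error_le hD (hC c hc) (norm_startVec hw₀ b) hv1 hb hε hε1 hv hd hT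
    hN b h1 h2
  have hacc : ∀ c ∈ cs, ∀ w ∈ iterates (batchesOf ω true) (batchesOf ω false) w₀ c,
      |(empErr (validOf ω) c w).val - D.real (errorSet c w)| ≤ 22 * √ε := by
    intro c' hc' w' hw'
    refine abs_empErr_sub_le_of_notMem_validDeviation hM (fun b i => ⟨?_, ?_⟩) hw'
    · simpa using h3 (⟨c', (hmem c').1 hc'⟩, b, i, true)
    · simpa using h3 (⟨c', (hmem c').1 hc'⟩, b, i, false)
  obtain ⟨c', hc', w', hw', hval, hle⟩ := ccfc_val_of_accurate hT0 hacc ((hmem c).2 hc)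
    ((mem_iterates_iff ω w₀ c _).2 ⟨b, i, rfl⟩)
  refine ⟨c', (hmem c').1 hc', w', ?_, hval, ?_⟩
  · obtain ⟨b', i', rfl⟩ := (mem_iterates_iff ω w₀ c' w').1 hw'
    exact norm_traj c' _ (norm_startVec hw₀ b') b' ω _
  -- The constant is `60 = 16 + 2 · 22`.
  · have e1 : √ε ≤ √ε * Real.log (1 / ε) :=
      le_mul_of_one_le_right (Real.sqrt_nonneg _) (one_le_log_inv hε hε1)
    linarith

end Correctness

end CondClass

end

theorem theorem1 :
    ∃ (K : ℝ) (k : ℕ),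
      ∀ (d : ℕ) (D : MeasureTheory.Measure (CondClass.Example d))
        [MeasureTheory.IsProbabilityMeasure D],
        D.fst = ProbabilityTheory.stdGaussian (CondClass.Vec d) →
      ∀ (C : Finset (CondClass.Classifier d)), (∀ c ∈ C, Measurable c) →
      ∀ (cs : List (CondClass.Classifier d)), (cs : Multiset (CondClass.Classifier d)) = C.val →
      ∀ (w₀ : CondClass.Vec d), ‖w₀‖ = 1 →
      ∀ (ε δ : ℝ), 0 < ε → ε ≤ 1 / Real.exp 1 → 0 < δ → δ < 1 →
        (∃ v : CondClass.Vec d, ‖v‖ = 1 ∧ ∃ c ∈ C, D.real (CondClass.errorSet c v) ≤ ε) →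
        -- number of examples
        (Fintype.card (CondClass.DrawIdx d cs.length ε δ) : ℝ) ≤
            K * ((d : ℝ) / ε ^ 6) * Real.log ((d : ℝ) * (C.card : ℝ) / (ε * δ)) ^ k ∧
        -- running time
        (∀ ω : CondClass.DrawIdx d cs.length ε δ → CondClass.Example d,
          ((CondClass.ccfc cs w₀ ε δ ω).steps : ℝ) ≤
            K * ((d : ℝ) * (C.card : ℝ) / ε ^ 6) *
              Real.log ((d : ℝ) * (C.card : ℝ) / (ε * δ)) ^ k) ∧
        -- failure has probability at most `δ`
        MeasureTheory.Measure.pi (fun _ : CondClass.DrawIdx d cs.length ε δ => D)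
            {ω | ¬ ∃ c ∈ C, ∃ w : CondClass.Vec d, ‖w‖ = 1 ∧
              (CondClass.ccfc cs w₀ ε δ ω).val = some (c, w) ∧
              D.real (CondClass.errorSet c w) ≤ K * Real.sqrt ε * Real.log (1 / ε) ^ k} ≤
          ENNReal.ofReal δ := by
  refine ⟨10 ^ 8, 3, ?_⟩
  intro d D _ hD C hC cs hcs w₀ hw₀ ε δ hε hε1 hδ hδ1 ⟨v, hv1, c, hc, hv⟩
  -- Dimension 0 is ruled out by the unit vector `w₀`.
  have hd : 0 < d := by
    rcases Nat.eq_zero_or_pos d with rfl | h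
    · rw [Subsingleton.elim w₀ 0, norm_zero] at hw₀
      exact absurd hw₀ zero_ne_one
    · exact h
  have hm : cs.length = C.card := by rw [Finset.card, ← hcs, Multiset.coe_card]
  have hm0 : 0 < cs.length := hm ▸ Finset.card_pos.2 ⟨c, hc⟩
  rw [← hm]
  refine ⟨?_, fun ω => ?_, ?_⟩
  · refine (CondClass.card_drawIdx_le hd hm0 hε hε1 hδ hδ1).trans (le_of_eq ?_)
    ring
  · refine (CondClass.steps_ccfc_real_le hd hε hε1 hδ hδ1 cs hm0 w₀ ω).trans (le_of_eq ?_)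
    ring
  · refine (MeasureTheory.measure_mono ?_).trans
      (CondClass.measure_ccfc_failure_le hD hε hε1 hδ hδ1 C hC cs hcs hw₀ hv1 hd hc hv)
    intro ω hω h
    apply hω
    obtain ⟨c', hc', w, hw, hval, hle⟩ := h
    refine ⟨c', hc', w, hw, hval, hle.trans ?_⟩
    have hL := CondClass.one_le_log_inv hε hε1
    have hL3 : Real.log (1 / ε) ≤ Real.log (1 / ε) ^ 3 := le_self_pow₀ hL (by norm_num)
    gcongr
    norm_num
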